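/- Let $\Omega\subset\mathbb R^2$ be a bounded domain, $T>0$, $\nu>0$. Write $(\cdot,\cdot)$, $\|\cdot\|_0$ for the $L^2(\Omega)$ inner product and norm (of scalars, vectors and matrices). There is a function $\alpha\mapsto C(\alpha)$, which depends only on $\Omega,\nu,T$ (and not on any of the discretization or reduction parameters below), such that the following holds for every $\alpha\in[0,3/8)$ and every time step $0<\tau<\frac{4}{17}\left(1-\frac83\alpha\right)$, with $N_t=\lfloor T/\tau\rfloor$. *Full-order solution.* Let $\mathcal T_h$ be a conforming triangulation of $\Omega$; let $U_h$ be the space of all $v\in H^1_0(\Omega)^2\cap C(\overline\Omega)^2$ with $v|_K\in\mathcal P_2(K)^2$ for all $K\in\mathcal T_h$, and $Q_h$ the space of all $q\in H^1(\Omega)$ with $\int_\Omega q=0$ and $q|_K\in\mathcal P_1(K)$ for all $K\in\mathcal T_h$. Let $f^n\in L^2(\Omega)^2$, and let $u_h^n\in U_h$, $p_h^n\in Q_h$ $(0\le n\le N_t)$ satisfy, for $2\le n<N_t$ (the levels $0,1,2$ being starting values), for all $v_h\in U_h$, $q_h\in Q_h$, $$\Big(\tfrac{3u_h^{n+1}-4u_h^n+u_h^{n-1}}{2\tau},v_h\Big)+\nu(\nabla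 u_h^{n+1},\nabla v_h)+\tfrac13\big(\nabla(7p_h^n-5p_h^{n-1}+p_h^{n-2}),v_h\big)=(f^{n+1},v_h),$$ $$(\nabla\cdot u_h^{n+1},q_h)+\tfrac{2\tau}{3}\big(\nabla(p_h^{n+1}-p_h^n),\nabla q_h\big)=0.$$ *POD.* Let $(u,v)_{W_u}=a_u(u,v)+b_u(\nabla u,\nabla v)$ and $(p,q)_{W_p}=a_p(p,q)+b_p(\nabla p,\nabla q)$, where $a_u,b_u,a_p,b_p\ge0$, $a_u+b_u>0$ and $a_p+b_p>0$ (for instance the $H^1_0$ inner products $a=0,b=1$, or the $L^2$ inner products $a=1,b=0$). Let $\lambda_1\ge\dots\ge\lambda_{N_t+1}\ge0$ be the eigenvalues and $w_1,\dots,w_{N_t+1}$ orthonormal eigenvectors of the correlation matrix $\frac1{N_t+1}\big((u_h^{i-1},u_h^{j-1})_{W_u}\big)_{i,j=1}^{N_t+1}$, and put $\varphi_i=\frac1{\sqrt{(N_t+1)\lambda_i}}\sum_{k=1}^{N_t+1}(w_i)_k\,u_h^{k-1}$ ($\varphi_i=0$ if $\lambda_i=0$); define $\sigma_i$ and $\psi_i$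 in the same way from the pressures $p_h^0,\dots,p_h^{N_t}$ and $(\cdot,\cdot)_{W_p}$. For $0\le N_u,N_p\le N_t+1$ let $U_r=\mathrm{span}\{\varphi_1,\dots,\varphi_{N_u}\}$ and $Q_r=\mathrm{span}\{\psi_1,\dots,\psi_{N_p}\}$, and suppose that $\alpha$ is a saturation constant for $U_r$ and $\mathrm{span}\{\nabla\psi_1,\dots,\nabla\psi_{N_p}\}$, i.e. $$|(y,z)|\le\alpha\|y\|_0\|z\|_0\qquad\text{for all } y\in U_r,\ z\in\mathrm{span}\{\nabla\psi_1,\dots,\nabla\psi_{N_p}\}.$$ *ROM solution.* Let $u_r^n\in U_r$, $p_r^n\in Q_r$ $(0\le n\le N_t)$ be such that, for each $n\le2$, $u_r^n$ and $p_r^n$ are the $W_u$- and $W_p$-orthogonal projections of $u_h^n$ onto $U_r$ and of $p_h^n$ onto $Q_r$, and, for $2\le n<N_t$ and all $v_r\in U_r$, $q_r\in Q_r$, $$\Big(\tfrac{3u_r^{n+1}-4u_r^n+u_r^{n-1}}{2\tau},v_r\Big)+\nu(\nabla u_r^{n+1},\nabla v_r)-\tfrac13\big(7p_r^n-5p_r^{n-1}+p_r^{n-2},\nabla\cdot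 v_r\big)=(f^{n+1},v_r),$$ $$(\nabla\cdot u_r^{n+1},q_r)+\tfrac{2\tau}{3}(\nabla p_r^{n+1},\nabla q_r)=\tfrac{2\tau}{3}(\nabla p_r^n,\nabla q_r).$$ Then $$\sum_{n=1}^{N_t-1}\tau\|u_r^{n+1}-u_h^{n+1}\|_0^2+2\nu\sum_{n=1}^{N_t-1}\tau\|\nabla(u_r^{n+1}-u_h^{n+1})\|_0^2+\frac{4\tau^2}{3}\sum_{n=1}^{N_t-1}\tau\|\nabla(p_r^{n+1}-p_h^{n+1})\|_0^2$$ $$\le C(\alpha)\,e^{T\frac{7\tau+4\alpha}{2}}\Big(\sum_{i=N_u+1}^{N_t+1}\lambda_i\big(\nu\tau^{-2}\|\varphi_i\|_0^2+\|\nabla\varphi_i\|_0^2\big)+\sum_{i=N_p+1}^{N_t+1}\sigma_i\big(\nu\|\psi_i\|_0^2+\|\nabla\psi_i\|_0^2\big)\Big).$$ -/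

import Mathlib

open MeasureTheory
open scoped ContDiff

noncomputable section

namespace StokesROM

/-! ### Lebesgue and Sobolev spaces on a planar domain -/

/-- The Euclidean plane. -/
abbrev Plane : Type := EuclideanSpace ℝ (Fin 2)

/-- `L²(Ω)`. -/
abbrev L2 (Ω : Set Plane) : Type := Lp ℝ 2 (volume.restrict Ω)

/-- `L²(Ω)²` with its Hilbert norm (velocities, gradients of scalars). -/
abbrev L2Vec (Ω : Set Plane) : Type := PiLp 2 (fun _ : Fin 2 => L2 Ω)

/-- `L²(Ω)^{2×2}` with its Hilbert (Frobenius) norm (gradients of velocities). -/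
abbrev L2Mat (Ω : Set Plane) : Type := PiLp 2 (fun _ : Fin 2 => L2Vec Ω)

/-- The partial derivative `∂ᵢ φ`. -/
def pderiv (i : Fin 2) (φ : Plane → ℝ) (x : Plane) : ℝ :=
  fderiv ℝ φ x (EuclideanSpace.single i 1)

/-- Test functions: smooth functions with compact support contained in `Ω`. -/
structure TestFn (Ω : Set Plane) where
  toFun : Plane → ℝ
  smooth : ContDiff ℝ ∞ toFun
  compact_supp : HasCompactSupport toFun
  supp_subset : tsupport toFun ⊆ Ω

theorem TestFn.memLp {Ω : Set Plane} (φ : TestFn Ω) :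
    MemLp φ.toFun 2 (volume.restrict Ω) :=
  (φ.smooth.continuous.memLp_of_hasCompactSupport φ.compact_supp).restrict Ω

theorem TestFn.pderiv_memLp {Ω : Set Plane} (φ : TestFn Ω) (i : Fin 2) :
    MemLp (pderiv i φ.toFun) 2 (volume.restrict Ω) := by
  have h1 : Continuous (pderiv i φ.toFun) :=
    (φ.smooth.continuous_fderiv (by simp)).clm_apply continuous_const
  have h2 : HasCompactSupport (pderiv i φ.toFun) :=
    φ.compact_supp.fderiv_apply (𝕜 := ℝ) _
  exact (h1.memLp_of_hasCompactSupport h2).restrict Ω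

/-- A test function as an element of `L²(Ω)`. -/
def TestFn.val {Ω : Set Plane} (φ : TestFn Ω) : L2 Ω := φ.memLp.toLp

/-- The gradient of a test function as an element of `L²(Ω)²`. -/
def TestFn.grad {Ω : Set Plane} (φ : TestFn Ω) : L2Vec Ω :=
  WithLp.toLp 2 fun i => (φ.pderiv_memLp i).toLp

/-- The Sobolev space `H¹(Ω)`: a function `q` is recorded as the pair `(q, ∇q)` of the function and
its weak gradient, i.e. `(q, ∂ᵢφ) = - (∂ᵢq, φ)` for all test functions `φ` and `i = 1, 2`. -/
def H1 (Ω : Set Plane) : Submodule ℝ (L2 Ω × L2Vec Ω) where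
  carrier := {q | ∀ (φ : TestFn Ω) (i : Fin 2),
    inner ℝ q.1 (φ.grad i) = - inner ℝ (q.2 i) φ.val}
  add_mem' := by
    intro q r hq hr φ i
    simp only [Prod.fst_add, Prod.snd_add, PiLp.add_apply, inner_add_left, hq φ i, hr φ i]
    ring
  zero_mem' := by
    intro φ i
    simp
  smul_mem' := by
    intro c q hq φ i
    simp only [Prod.smul_fst, Prod.smul_snd, PiLp.smul_apply, real_inner_smul_left, hq φ i]
    ring

/-- `H¹₀(Ω)`: the closure in `H¹(Ω)` of the test functions, again as pairs `(v, ∇v)`. -/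
def H10 (Ω : Set Plane) : Submodule ℝ (L2 Ω × L2Vec Ω) :=
  (Submodule.span ℝ (Set.range fun φ : TestFn Ω => (φ.val, φ.grad))).topologicalClosure

/-- Scalar functions with gradient: pairs `(q, ∇q)`. -/
abbrev Scalar (Ω : Set Plane) : Type := L2 Ω × L2Vec Ω

/-- Vector fields with gradient: the components `(vᵢ, ∇vᵢ)`, `i = 1, 2`. -/
abbrev Vel (Ω : Set Plane) : Type := Fin 2 → Scalar Ω

/-- The vector field itself, in `L²(Ω)²`. -/
def velVal {Ω : Set Plane} (v : Vel Ω) : L2Vec Ω := WithLp.toLp 2 fun i => (v i).1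

/-- The gradient of a vector field, in `L²(Ω)^{2×2}`. -/
def velGrad {Ω : Set Plane} (v : Vel Ω) : L2Mat Ω := WithLp.toLp 2 fun i => (v i).2

/-- The divergence of a vector field, in `L²(Ω)`. -/
def velDiv {Ω : Set Plane} (v : Vel Ω) : L2 Ω := ∑ i, (v i).2 i

/-! ### Triangulations and the finite element spaces -/

/-- `𝒯` (given by the vertex sets of its triangles) is a conforming triangulation of `Ω`: finitely
many nondegenerate closed triangles that cover the closure of `Ω` exactly, any two of which meet
in the (possibly empty) face spanned by their common vertices. -/
structure IsTriangulation (Ω : Set Plane) (𝒯 : Set (Finset Plane)) : Prop where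
  finite : 𝒯.Finite
  card_eq : ∀ s ∈ 𝒯, s.card = 3
  nondegenerate : ∀ s ∈ 𝒯, AffineIndependent ℝ (fun x : s => (x : Plane))
  cover : (⋃ s ∈ 𝒯, convexHull ℝ (s : Set Plane)) = closure Ω
  conforming : ∀ s ∈ 𝒯, ∀ t ∈ 𝒯,
    convexHull ℝ (s : Set Plane) ∩ convexHull ℝ (t : Set Plane) =
      convexHull ℝ ((s : Set Plane) ∩ (t : Set Plane))

/-- The pressure space `Q_h`: functions in `H¹(Ω)` with mean value zero that are polynomials of
degree at most `1` on each triangle. -/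
def pressureSpace (Ω : Set Plane) (𝒯 : Set (Finset Plane)) : Set (Scalar Ω) :=
  {q | q ∈ H1 Ω ∧ ∫ x in Ω, q.1 x = 0 ∧
    ∀ s ∈ 𝒯, ∃ P : MvPolynomial (Fin 2) ℝ, P.totalDegree ≤ 1 ∧
      ∀ᵐ x ∂(volume.restrict Ω), x ∈ convexHull ℝ (s : Set Plane) →
        q.1 x = MvPolynomial.eval (fun i => x i) P}

/-- The velocity space `U_h`: vector fields in `H¹₀(Ω)²` whose components are continuous on the
closure of `Ω` and are polynomials of degree at most `2` on each triangle. -/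
def velocitySpace (Ω : Set Plane) (𝒯 : Set (Finset Plane)) : Set (Vel Ω) :=
  {v | ∀ i, v i ∈ H10 Ω ∧ ∃ g : Plane → ℝ, ContinuousOn g (closure Ω) ∧
    (∀ᵐ x ∂(volume.restrict Ω), (v i).1 x = g x) ∧
    ∀ s ∈ 𝒯, ∃ P : MvPolynomial (Fin 2) ℝ, P.totalDegree ≤ 2 ∧
      ∀ x ∈ convexHull ℝ (s : Set Plane), g x = MvPolynomial.eval (fun i => x i) P}

/-! ### Proper orthogonal decomposition -/

/-- The inner product `a (u, v) + b (∇u, ∇v)` on velocities; `(a, b) = (0, 1)` is the `H¹₀` inner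
product and `(a, b) = (1, 0)` the `L²` inner product. -/
def velInner {Ω : Set Plane} (a b : ℝ) (u v : Vel Ω) : ℝ :=
  a * inner ℝ (velVal u) (velVal v) + b * inner ℝ (velGrad u) (velGrad v)

/-- The inner product `a (p, q) + b (∇p, ∇q)` on pressures. -/
def presInner {Ω : Set Plane} (a b : ℝ) (p q : Scalar Ω) : ℝ :=
  a * inner ℝ p.1 q.1 + b * inner ℝ p.2 q.2

section POD

variable {V : Type*} [AddCommGroup V] [Module ℝ V]

/-- The correlation matrix `K i j = (s i, s j)_W / (N + 1)` of the snapshots `s 0, …, s N`, with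
respect to the inner product `B = (·,·)_W`. -/
def correlation (B : V → V → ℝ) (N : ℕ) (s : ℕ → V) : Matrix (Fin (N + 1)) (Fin (N + 1)) ℝ :=
  Matrix.of fun i j => 1 / ((N : ℝ) + 1) * B (s i) (s j)

/-- `lam` and `w` are the eigenvalues, in nonincreasing order, and an orthonormal system of
eigenvectors of the correlation matrix. -/
structure IsPODSystem (B : V → V → ℝ) (N : ℕ) (s : ℕ → V) (lam : Fin (N + 1) → ℝ)
    (w : Fin (N + 1) → EuclideanSpace ℝ (Fin (N + 1))) : Prop where
  sorted : Antitone lam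
  orthonormal : Orthonormal ℝ w
  eigen : ∀ i j, ∑ k, correlation B N s j k * w i k = lam i * w i j

/-- The `i`-th POD mode `((N + 1) λᵢ)^{-1/2} ∑ₖ (wᵢ)ₖ sₖ` (which is `0` if `λᵢ = 0`). -/
def podMode (N : ℕ) (s : ℕ → V) (lam : Fin (N + 1) → ℝ)
    (w : Fin (N + 1) → EuclideanSpace ℝ (Fin (N + 1))) (i : Fin (N + 1)) : V :=
  (1 / Real.sqrt (((N : ℝ) + 1) * lam i)) • ∑ k, w i k • s k

/-- The span of the first `r` POD modes. -/
def podSpace (N : ℕ) (s : ℕ → V) (lam : Fin (N + 1) → ℝ)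
    (w : Fin (N + 1) → EuclideanSpace ℝ (Fin (N + 1))) (r : ℕ) : Submodule ℝ V :=
  Submodule.span ℝ {v | ∃ i : Fin (N + 1), (i : ℕ) < r ∧ v = podMode N s lam w i}

/-- `y` is the projection of `x` onto `S` that is orthogonal with respect to `B`. -/
def IsProjection (B : V → V → ℝ) (S : Submodule ℝ V) (x y : V) : Prop :=
  y ∈ S ∧ ∀ v ∈ S, B (x - y) v = 0

end POD

/-- The inequality `|(y, z)| ≤ α ‖y‖ ‖z‖` for `y ∈ Y`, `z ∈ Z`. -/
def SaturationBound {X : Type*} [NormedAddCommGroup X] [InnerProductSpace ℝ X]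
    (Y Z : Set X) (α : ℝ) : Prop :=
  ∀ y ∈ Y, ∀ z ∈ Z, |inner ℝ y z| ≤ α * ‖y‖ * ‖z‖

/-! ### The full-order and the reduced-order scheme -/

/-- `(u, p)` solves the fully discrete BDF2 incremental projection scheme with `N` time steps. The
levels `0, 1, 2` are starting values in the finite element spaces; the three-level scheme produces
the levels `n + 1` with `2 ≤ n < N`. -/
structure IsFOMSolution (Ω : Set Plane) (𝒯 : Set (Finset Plane)) (ν τ : ℝ) (N : ℕ)
    (f : ℕ → L2Vec Ω) (u : ℕ → Vel Ω) (p : ℕ → Scalar Ω) : Prop where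
  vel_mem : ∀ n ≤ N, u n ∈ velocitySpace Ω 𝒯
  pres_mem : ∀ n ≤ N, p n ∈ pressureSpace Ω 𝒯
  momentum : ∀ n, 2 ≤ n → n < N → ∀ v ∈ velocitySpace Ω 𝒯,
    inner ℝ ((1 / (2 * τ)) • velVal ((3 : ℝ) • u (n + 1) - (4 : ℝ) • u n + u (n - 1))) (velVal v)
      + ν * inner ℝ (velGrad (u (n + 1))) (velGrad v)
      + 1 / 3 * inner ℝ ((7 : ℝ) • p n - (5 : ℝ) • p (n - 1) + p (n - 2)).2 (velVal v)
      = inner ℝ (f (n + 1)) (velVal v)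
  projection : ∀ n, 2 ≤ n → n < N → ∀ q ∈ pressureSpace Ω 𝒯,
    inner ℝ (velDiv (u (n + 1))) q.1 + 2 * τ / 3 * inner ℝ (p (n + 1) - p n).2 q.2 = 0

/-- `(u, p)` solves the reduced-order scheme in the spaces `U` and `Q`. -/
structure IsROMSolution {Ω : Set Plane} (U : Submodule ℝ (Vel Ω)) (Q : Submodule ℝ (Scalar Ω))
    (ν τ : ℝ) (N : ℕ) (f : ℕ → L2Vec Ω) (u : ℕ → Vel Ω) (p : ℕ → Scalar Ω) : Prop where
  vel_mem : ∀ n ≤ N, u n ∈ U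
  pres_mem : ∀ n ≤ N, p n ∈ Q
  momentum : ∀ n, 2 ≤ n → n < N → ∀ v ∈ U,
    inner ℝ ((1 / (2 * τ)) • velVal ((3 : ℝ) • u (n + 1) - (4 : ℝ) • u n + u (n - 1))) (velVal v)
      + ν * inner ℝ (velGrad (u (n + 1))) (velGrad v)
      - 1 / 3 * inner ℝ ((7 : ℝ) • p n - (5 : ℝ) • p (n - 1) + p (n - 2)).1 (velDiv v)
      = inner ℝ (f (n + 1)) (velVal v)
  projection : ∀ n, 2 ≤ n → n < N → ∀ q ∈ Q,
    inner ℝ (velDiv (u (n + 1))) q.1 + 2 * τ / 3 * inner ℝ (p (n + 1)).2 q.2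
      = 2 * τ / 3 * inner ℝ (p n).2 q.2

end StokesROM

end

noncomputable section

namespace StokesROM

/-! ### A discrete energy estimate -/

/-! Let `G` be the span of the reduced pressure gradients and `P` the L² projection onto it. Compare
the reduced solution with the truncated POD expansions of the snapshots: `e` is the velocity
difference and `g` is `τ` times the difference of the pressure gradients. After integration by parts
the pressure step reads `g_{n+1} - g_n = (3/2) P e_{n+1} + r_{n+1}`, where `r` comes from truncation
only. Inserting this three times, the extrapolated pressure `(7 g_n - 5 g_{n-1} + g_{n-2}) / 3`
becomes `g_{n+1} - (3 P e_{n+1} - 4 P e_n + P e_{n-1}) / 2` plus remainders. The difference quotient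
is thereby left acting on `(1 - P) e` alone, where the G-stability of BDF2 applies, while `(g_{n+1},
e_{n+1})` telescopes in `‖g‖² / 3`; this is `energy_step`. Saturation with `α ≤ 1/2` gives `‖(1 - P)
e‖² ≥ (3/4) ‖e‖²`, so the energy controls `e`.

The truncation terms are absorbed by Young's inequality with weight `τ / (2T)` per step. These
weights add up to at most `1/2`, so looking at the largest energy replaces Grönwall's lemma
(`implicit_recursion_bound`, `scheme_stability`). The constant is therefore independent of `α`, and
the exponential in the claim is used only through being at least `1`.

It remains to sum the truncation errors. The eigenvectors form an orthogonal matrix, so the mean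
square truncation error equals the weighted tail of the modes in every seminorm that vanishes on
`W`-null elements (`IsPODSystem.sum_norm_sq_sub`). A velocity in `H¹₀` vanishes exactly when its
gradient does, and a vanishing pressure has vanishing gradient; hence every admissible choice of
weights works, and the starting values agree with the truncations in all the norms that matter, so
the initial energy is zero. Velocity truncation errors enter as `τ⁻¹ ∑ ‖·‖²`; with `(N + 1) τ ≤ T +
1` this is the `τ⁻²` of the bound. -/

theorem sum_shift_le {y : ℕ → ℝ} (hy : ∀ n, 0 ≤ y n) (N : ℕ) {k : ℕ} (hk : k ≤ 3) :
    ∑ n ∈ Finset.Ico 2 N, y (n + 1 - k) ≤ ∑ j ∈ Finset.range (N + 1), y j := by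
  rw [← Finset.sum_image (f := y) (g := fun n => n + 1 - k) (s := Finset.Ico 2 N)]
  · refine Finset.sum_le_sum_of_subset_of_nonneg ?_ fun i _ _ => hy i
    intro j hj
    simp only [Finset.mem_image, Finset.mem_Ico, Finset.mem_range] at hj ⊢
    omega
  · intro i hi j hj h
    simp only [Finset.coe_Ico, Set.mem_Ico] at hi hj h
    omega

/-- If an implicit recursion loses at most a small multiple of the new value in each step, then the
values are bounded by the accumulated data. -/
theorem implicit_recursion_bound {E d F : ℕ → ℝ} {k : ℝ} {N : ℕ} (hE : ∀ n, 0 ≤ E n)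
    (hd : ∀ n, 0 ≤ d n) (hF : ∀ n, 0 ≤ F n) (hk : 0 ≤ k) (hkN : k * N ≤ 1 / 2) (hE2 : E 2 = 0)
    (hstep : ∀ n, 2 ≤ n → n < N → E (n + 1) + d (n + 1) ≤ E n + k * E (n + 1) + F n) :
    (∀ m, 2 ≤ m → m ≤ N → E m ≤ 2 * ∑ n ∈ Finset.Ico 2 N, F n) ∧
      ∑ n ∈ Finset.Ico 2 N, d (n + 1) ≤ 2 * ∑ n ∈ Finset.Ico 2 N, F n := by
  rcases lt_or_ge N 2 with hN | hN
  · refine ⟨fun m h1 h2 => by omega, ?_⟩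
    rw [Finset.Ico_eq_empty (by omega)]
    simp
  have hsum : ∀ m, 2 ≤ m → m ≤ N → E m + ∑ n ∈ Finset.Ico 2 m, d (n + 1) ≤
      k * ∑ n ∈ Finset.Ico 2 m, E (n + 1) + ∑ n ∈ Finset.Ico 2 m, F n := by
    intro m hm
    induction m, hm using Nat.le_induction with
    | base => intro _; simp [hE2]
    | succ m hm ih =>
      intro hmN
      have h1 := ih (by omega)
      have h2 := hstep m hm (by omega)
      rw [Finset.sum_Ico_succ_top hm, Finset.sum_Ico_succ_top hm, Finset.sum_Ico_succ_top hm]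
      linarith [mul_add k (∑ n ∈ Finset.Ico 2 m, E (n + 1)) (E (m + 1))]
  -- At the level `M` of largest energy the accumulated loss is at most `k N E_M ≤ E_M / 2`, which
  -- the left side absorbs.
  obtain ⟨M, hM, hmax⟩ := Finset.exists_max_image (Finset.Icc 2 N) E ⟨2, by simp [hN]⟩
  rw [Finset.mem_Icc] at hM
  have hbd : ∀ m, 2 ≤ m → m ≤ N → E m + ∑ n ∈ Finset.Ico 2 m, d (n + 1) ≤
      1 / 2 * E M + ∑ n ∈ Finset.Ico 2 N, F n := by
    intro m h2 hmN
    refine (hsum m h2 hmN).trans (add_le_add ?_ ?_)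
    · have h3 : ∑ n ∈ Finset.Ico 2 m, E (n + 1) ≤ N * E M := by
        calc ∑ n ∈ Finset.Ico 2 m, E (n + 1) ≤ ∑ n ∈ Finset.Ico 2 m, E M := by
              refine Finset.sum_le_sum fun n hn => hmax _ ?_
              simp only [Finset.mem_Ico, Finset.mem_Icc] at hn ⊢
              omega
          _ = ((m - 2 : ℕ) : ℝ) * E M := by simp
          _ ≤ N * E M := by
              refine mul_le_mul_of_nonneg_right ?_ (hE M)
              exact_mod_cast (by omega : m - 2 ≤ N)
      calc k * ∑ n ∈ Finset.Ico 2 m, E (n + 1) ≤ k * (N * E M) :=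
            mul_le_mul_of_nonneg_left h3 hk
        _ = k * N * E M := by ring
        _ ≤ 1 / 2 * E M := mul_le_mul_of_nonneg_right hkN (hE M)
    · refine Finset.sum_le_sum_of_subset_of_nonneg ?_ fun i _ _ => hF i
      exact Finset.Ico_subset_Ico_right hmN
  have hEM : E M ≤ 2 * ∑ n ∈ Finset.Ico 2 N, F n := by
    have h1 := hbd M hM.1 hM.2
    have h2 : 0 ≤ ∑ n ∈ Finset.Ico 2 M, d (n + 1) := Finset.sum_nonneg fun n _ => hd _
    linarith
  refine ⟨fun m h1 h2 => (hmax m (by simp [h1, h2])).trans hEM, ?_⟩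
  have h1 := hbd N hN le_rfl
  linarith [hE N]

/-! ### G-stability and elimination of the pressure in an inner product space -/

section Energy

variable {X Y : Type*} [NormedAddCommGroup X] [InnerProductSpace ℝ X]

/-- The `G`-stability of the two-step backward differentiation formula. -/
theorem bdf2_inner_ge (x y z : X) :
    1 / 4 * (‖x‖ ^ 2 + ‖(2 : ℝ) • x - y‖ ^ 2) - 1 / 4 * (‖y‖ ^ 2 + ‖(2 : ℝ) • y - z‖ ^ 2) ≤
      1 / 2 * inner ℝ ((3 : ℝ) • x - (4 : ℝ) • y + z) x := by
  -- The two sides differ by exactly `‖x - 2y + z‖² / 4`.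
  have h := real_inner_self_nonneg (x := x - (2 : ℝ) • y + z)
  simp only [← real_inner_self_eq_norm_sq, inner_sub_left, inner_sub_right, inner_add_left,
    inner_add_right, real_inner_smul_left, real_inner_smul_right] at h ⊢
  rw [real_inner_comm x y, real_inner_comm x z, real_inner_comm y z] at *
  linarith

/-- Test with the projection `z = P y` itself, for which `(y, z) = ‖P y‖²`. -/
theorem norm_starProjection_le_of_inner_le (G : Submodule ℝ X) [G.HasOrthogonalProjection]
    {α : ℝ} {y : X} (h : ∀ z ∈ G, |inner ℝ y z| ≤ α * ‖y‖ * ‖z‖) :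
    ‖G.starProjection y‖ ^ 2 ≤ α ^ 2 * ‖y‖ ^ 2 := by
  have h1 := h _ (G.starProjection_apply_mem y)
  have h2 : inner ℝ y (G.starProjection y) = ‖G.starProjection y‖ ^ 2 := by
    have := G.starProjection_inner_eq_zero y (G.starProjection y) (G.starProjection_apply_mem y)
    rw [inner_sub_left, real_inner_self_eq_norm_sq] at this
    linarith
  rw [h2, abs_of_nonneg (by positivity)] at h1
  rcases (norm_nonneg (G.starProjection y)).eq_or_lt with h0 | h0
  · rw [← h0, zero_pow two_ne_zero]; positivity
  · have h3 : ‖G.starProjection y‖ ≤ α * ‖y‖ := by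
      by_contra! hc
      nlinarith
    calc _ ≤ (α * ‖y‖) ^ 2 := by gcongr
      _ = _ := by ring

/-- The energy of two consecutive velocities and a scaled pressure gradient. -/
def energy (x y g : X) : ℝ :=
  1 / 4 * (‖x‖ ^ 2 + ‖(2 : ℝ) • x - y‖ ^ 2) + 1 / 3 * ‖g‖ ^ 2

theorem energy_nonneg (x y g : X) : 0 ≤ energy x y g := by unfold energy; positivity

/-- Rewriting the extrapolated pressure through the projection step removes from the difference
quotient its component along pressure gradients. -/
theorem energy_step (G : Submodule ℝ X) [G.HasOrthogonalProjection]
    {e₀ e₁ e₂ g₀ g₁ g₂ g₃ r₀ r₁ r₂ : X} (hg₃ : g₃ ∈ G)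
    (h₂ : g₃ - g₂ = (3 / 2 : ℝ) • G.starProjection e₂ + r₂)
    (h₁ : g₂ - g₁ = (3 / 2 : ℝ) • G.starProjection e₁ + r₁)
    (h₀ : g₁ - g₀ = (3 / 2 : ℝ) • G.starProjection e₀ + r₀) :
    energy (e₂ - G.starProjection e₂) (e₁ - G.starProjection e₁) g₃
      ≤ energy (e₁ - G.starProjection e₁) (e₀ - G.starProjection e₀) g₂
        + (1 / 2 * inner ℝ ((3 : ℝ) • e₂ - (4 : ℝ) • e₁ + e₀) e₂
          + 1 / 3 * inner ℝ ((7 : ℝ) • g₂ - (5 : ℝ) • g₁ + g₀) e₂)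
        + 2 / 3 * (‖g₃‖ * ‖r₂‖) + (‖r₂‖ + 4 / 3 * ‖r₁‖ + 1 / 3 * ‖r₀‖) * ‖e₂‖ := by
  set P := G.starProjection
  have hort : ∀ x y : X, inner ℝ (P x) (y - P y) = 0 := fun x y => by
    rw [real_inner_comm]
    exact G.starProjection_inner_eq_zero y _ (G.starProjection_apply_mem x)
  have hg₃e : inner ℝ g₃ (e₂ - P e₂) = 0 := by
    rw [real_inner_comm]
    exact G.starProjection_inner_eq_zero e₂ _ hg₃
  have hb := bdf2_inner_ge (e₂ - P e₂) (e₁ - P e₁) (e₀ - P e₀)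
  -- Testing with `e₂ - P e₂` or with `e₂` is the same here, because differences of vectors `e - P
  -- e` are orthogonal to `P e₂`.
  have hcomp : inner ℝ ((3 : ℝ) • (e₂ - P e₂) - (4 : ℝ) • (e₁ - P e₁) + (e₀ - P e₀)) (e₂ - P e₂)
      = inner ℝ ((3 : ℝ) • e₂ - (4 : ℝ) • e₁ + e₀) e₂
        - inner ℝ ((3 : ℝ) • P e₂ - (4 : ℝ) • P e₁ + P e₀) e₂ := by
    have h3 : inner ℝ ((3 : ℝ) • (e₂ - P e₂) - (4 : ℝ) • (e₁ - P e₁) + (e₀ - P e₀)) (P e₂) = 0 := by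
      have := fun y : X => (real_inner_comm _ _).trans (hort e₂ y)
      simp only [inner_add_left, inner_sub_left, real_inner_smul_left] at this ⊢
      linarith [this e₀, this e₁, this e₂]
    rw [inner_sub_right, h3, sub_zero, ← inner_sub_left]
    congr 1
    module
  -- Write the extrapolation as `g₃ - (g₃ - g₂) + (4/3) (g₂ - g₁) - (1/3) (g₁ - g₀)`; multiplied by
  -- `3/2`, the coefficients `1, 4/3, 1/3` become those of BDF2, up to the factor `1/2`.
  have hextra : (1 / 3 : ℝ) • ((7 : ℝ) • g₂ - (5 : ℝ) • g₁ + g₀)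
      = g₃ - (1 / 2 : ℝ) • ((3 : ℝ) • P e₂ - (4 : ℝ) • P e₁ + P e₀)
        - r₂ + (4 / 3 : ℝ) • r₁ - (1 / 3 : ℝ) • r₀ := by
    have k2 : r₂ = g₃ - g₂ - (3 / 2 : ℝ) • P e₂ := by rw [h₂]; module
    have k1 : r₁ = g₂ - g₁ - (3 / 2 : ℝ) • P e₁ := by rw [h₁]; module
    have k0 : r₀ = g₁ - g₀ - (3 / 2 : ℝ) • P e₀ := by rw [h₀]; module
    rw [k2, k1, k0]
    module
  have hextra' := congrArg (fun x => inner ℝ x e₂) hextra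
  simp only [real_inner_smul_left (_ : X) _ (1 / 3 : ℝ), inner_sub_left (_ : X) r₂,
    inner_sub_left (_ : X) ((1 / 3 : ℝ) • r₀), inner_add_left _ ((4 / 3 : ℝ) • r₁),
    inner_sub_left g₃, real_inner_smul_left r₁,
    real_inner_smul_left (_ : X) _ (1 / 2 : ℝ)] at hextra'
  -- Since `g₃` lies in `G`, only `P e₂ = (2/3) (g₃ - g₂ - r₂)` is seen, and `(g₃, g₃ - g₂) ≥ (‖g₃‖²
  -- - ‖g₂‖²) / 2`.
  have hg : 1 / 3 * ‖g₃‖ ^ 2 - 1 / 3 * ‖g₂‖ ^ 2 - 2 / 3 * (‖g₃‖ * ‖r₂‖) ≤ inner ℝ g₃ e₂ := by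
    have e1 : inner ℝ g₃ e₂ = inner ℝ g₃ (P e₂) := by
      rw [inner_sub_right] at hg₃e; linarith
    have e2 : P e₂ = (2 / 3 : ℝ) • (g₃ - g₂ - r₂) := by rw [h₂]; module
    rw [e1, e2, real_inner_smul_right, inner_sub_right, inner_sub_right,
      real_inner_self_eq_norm_sq]
    nlinarith [real_inner_le_norm g₃ r₂, real_inner_le_norm g₃ g₂, sq_nonneg (‖g₃‖ - ‖g₂‖)]
  have c2 := real_inner_le_norm r₂ e₂
  have c1 := neg_le_of_abs_le (abs_real_inner_le_norm r₁ e₂)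
  have c0 := real_inner_le_norm r₀ e₂
  unfold energy
  linarith

/-- By Pythagoras `‖x‖² ≥ (3/4) ‖e‖²`, and the energy contains `‖x‖² / 4`. -/
theorem norm_sq_le_energy {x e p g y : X} (hp : ‖p‖ ^ 2 ≤ 1 / 4 * ‖e‖ ^ 2) (hx : x = e - p)
    (hort : inner ℝ x p = 0) : 3 / 16 * ‖e‖ ^ 2 + 1 / 3 * ‖g‖ ^ 2 ≤ energy x y g := by
  have h1 : ‖e‖ ^ 2 = ‖x‖ ^ 2 + ‖p‖ ^ 2 := by
    have : e = x + p := by rw [hx]; abel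
    rw [this, norm_add_sq_real, hort]
    ring
  unfold energy
  nlinarith [sq_nonneg ‖(2 : ℝ) • x - y‖]

theorem add_four_sq_le (x y z w : ℝ) :
    (x + y + z + w) ^ 2 ≤ 4 * (x ^ 2 + y ^ 2 + z ^ 2 + w ^ 2) := by
  nlinarith [sq_nonneg (x - y), sq_nonneg (x - z), sq_nonneg (x - w), sq_nonneg (y - z),
    sq_nonneg (y - w), sq_nonneg (z - w)]

/-- Complete both squares; this costs `100/3 + 3/4 < 70` multiples of `ξ² / k`. The weights `3/16`
and `1/3` are those with which the energy controls velocity and pressure. -/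
theorem young_absorb {k : ℝ} (hk : 0 < k) (ξ s t : ℝ) :
    5 * ξ * s + ξ * t ≤ k * (3 / 16 * s ^ 2 + 1 / 3 * t ^ 2) + 70 * (ξ ^ 2 / k) := by
  have h : k * (3 / 16 * s ^ 2 + 1 / 3 * t ^ 2) + 70 * (ξ ^ 2 / k) - (5 * ξ * s + ξ * t)
      = (3 / 16 * (k * s - 40 / 3 * ξ) ^ 2 + 1 / 3 * (k * t - 3 / 2 * ξ) ^ 2
        + (70 - 100 / 3 - 3 / 4) * ξ ^ 2) / k := by
    field_simp
    ring
  have h2 : 0 ≤ (3 / 16 * (k * s - 40 / 3 * ξ) ^ 2 + 1 / 3 * (k * t - 3 / 2 * ξ) ^ 2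
        + (70 - 100 / 3 - 3 / 4) * ξ ^ 2) / k := by
    have : (0 : ℝ) ≤ 70 - 100 / 3 - 3 / 4 := by norm_num
    positivity
  linarith

variable [NormedAddCommGroup Y]

/-- Stability of the three-level scheme in energy form: `e` is the velocity error in the reduced
space, `de` its gradient and `g` the gradient of the pressure error, multiplied by the time step. -/
theorem scheme_stability (G : Submodule ℝ X) [G.HasOrthogonalProjection] {ν τ T : ℝ} {N : ℕ}
    (hν : 0 < ν) (hτ : 0 < τ) (hT : 0 < T) (hN : N * τ ≤ T) {e g : ℕ → X} {de : ℕ → Y}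
    {a b c : ℕ → ℝ} (ha : ∀ n, 0 ≤ a n) (hb : ∀ n, 0 ≤ b n) (hg : ∀ n, g n ∈ G)
    (hsat : ∀ n ≤ N, ‖G.starProjection (e n)‖ ^ 2 ≤ 1 / 4 * ‖e n‖ ^ 2)
    (he0 : ∀ n ≤ 2, n ≤ N → e n = 0) (hg0 : ∀ n ≤ 2, n ≤ N → g n = 0)
    (hproj : ∀ n, 2 ≤ n → n < N →
      ‖g (n + 1) - g n - (3 / 2 : ℝ) • G.starProjection (e (n + 1))‖
        ≤ 3 / 2 * a (n + 1) + b (n + 1) + b n)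
    (hmom : ∀ n, 2 ≤ n → n < N →
      1 / 2 * inner ℝ ((3 : ℝ) • e (n + 1) - (4 : ℝ) • e n + e (n - 1)) (e (n + 1))
        + ν * τ * ‖de (n + 1)‖ ^ 2
        + 1 / 3 * inner ℝ ((7 : ℝ) • g n - (5 : ℝ) • g (n - 1) + g (n - 2)) (e (n + 1))
      ≤ (1 / 2 * (3 * a (n + 1) + 4 * a n + a (n - 1))
          + 1 / 3 * (7 * b n + 5 * b (n - 1) + b (n - 2))) * ‖e (n + 1)‖
        + ν * τ * (c (n + 1) * ‖de (n + 1)‖)) :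
    (∀ n, 2 ≤ n → n ≤ N → 3 / 16 * ‖e n‖ ^ 2 + 1 / 3 * ‖g n‖ ^ 2 ≤
        4480 * (T / τ) * ∑ j ∈ Finset.range (N + 1), (a j + b j) ^ 2
          + ν * τ * ∑ j ∈ Finset.range (N + 1), c j ^ 2) ∧
      1 / 2 * (ν * τ) * ∑ n ∈ Finset.Ico 2 N, ‖de (n + 1)‖ ^ 2 ≤
        4480 * (T / τ) * ∑ j ∈ Finset.range (N + 1), (a j + b j) ^ 2
          + ν * τ * ∑ j ∈ Finset.range (N + 1), c j ^ 2 := by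
  rcases lt_or_ge N 2 with hN2 | hN2
  · have hR : 0 ≤ 4480 * (T / τ) * ∑ j ∈ Finset.range (N + 1), (a j + b j) ^ 2
          + ν * τ * ∑ j ∈ Finset.range (N + 1), c j ^ 2 := by positivity
    refine ⟨fun n h1 h2 => by omega, ?_⟩
    rw [Finset.Ico_eq_empty (by omega)]
    simpa using hR
  set P := G.starProjection with hP
  set D : ℕ → ℝ := fun n => 3 / 2 * a n + b n + b (n - 1) with hD
  set r : ℕ → X := fun n => g n - g (n - 1) - (3 / 2 : ℝ) • P (e n) with hr
  have hrD : ∀ n ≤ N, ‖r n‖ ≤ D n := by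
    intro n hn
    rcases le_or_gt n 2 with h2 | h2
    -- The starting levels need not satisfy the pressure step, but there all errors vanish. This
    -- includes `n = 0`, where `n - 1` is again `0`.
    · have : r n = 0 := by
        simp only [hr]
        rw [he0 n h2 hn, hg0 n h2 hn, hg0 (n - 1) (by omega) (by omega)]
        simp
      rw [this, norm_zero]
      have := ha n; have := hb n; have := hb (n - 1)
      simp only [hD]; positivity
    · obtain ⟨m, rfl⟩ : ∃ m, n = m + 1 := ⟨n - 1, by omega⟩
      exact hproj m (by omega) (by omega)
  have hrg : ∀ n, g n - g (n - 1) = (3 / 2 : ℝ) • P (e n) + r n := fun n => by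
    simp only [hr]; abel
  set x : ℕ → ℝ := fun n => a n + b n with hx
  have hx0 : ∀ n, 0 ≤ x n := fun n => add_nonneg (ha n) (hb n)
  set E : ℕ → ℝ := fun n => energy (e n - P (e n)) (e (n - 1) - P (e (n - 1))) (g n) with hE
  -- Chosen so that `k * N ≤ 1 / 2`, using `N * τ ≤ T`.
  set k : ℝ := τ / (2 * T) with hk
  have hk0 : 0 < k := by positivity
  have hEge : ∀ n ≤ N, 3 / 16 * ‖e n‖ ^ 2 + 1 / 3 * ‖g n‖ ^ 2 ≤ E n := by
    intro n hn
    have := norm_sq_le_energy (g := g n) (y := e (n - 1) - P (e (n - 1))) (hsat n hn) rfl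
      (G.starProjection_inner_eq_zero (e n) _ (G.starProjection_apply_mem (e n)))
    simp only [hE]
    linarith
  set F : ℕ → ℝ := fun n => 140 * (T / τ) *
      (4 * (x (n + 1) ^ 2 + x n ^ 2 + x (n - 1) ^ 2 + x (n - 2) ^ 2))
      + 1 / 2 * (ν * τ) * c (n + 1) ^ 2 with hF
  have hstep : ∀ n, 2 ≤ n → n < N →
      E (n + 1) + 1 / 2 * (ν * τ) * ‖de (n + 1)‖ ^ 2 ≤ E n + k * E (n + 1) + F n := by
    intro n h2 hn
    have hs := energy_step G (hg (n + 1)) (hrg (n + 1)) (hrg n) (hrg (n - 1))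
    have hm := hmom n h2 hn
    have d2 := hrD (n + 1) (by omega)
    have d1 := hrD n (by omega)
    have d0 := hrD (n - 1) (by omega)
    have hEn := hEge (n + 1) (by omega)
    have ep : n + 1 - 1 = n := by omega
    have em : n - 1 - 1 = n - 2 := by omega
    simp only [hD, ep, em] at d2 d1 d0
    simp only [ep, em] at hs
    have q3 := ha (n + 1); have q2 := ha n; have q1 := ha (n - 1); have q0 := ha (n - 2)
    have p3 := hb (n + 1); have p2 := hb n; have p1 := hb (n - 1); have p0 := hb (n - 2)
    set ξ : ℝ := x (n + 1) + x n + x (n - 1) + x (n - 2) with hξ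
    have hξ0 : 0 ≤ ξ := by
      have := hx0 (n + 1); have := hx0 n; have := hx0 (n - 1); have := hx0 (n - 2)
      positivity
    -- Collecting the momentum defect and the three remainders, the largest coefficient is `14/3`,
    -- that of `b n`; hence the `5`.
    have u1 : (1 / 2 * (3 * a (n + 1) + 4 * a n + a (n - 1))
        + 1 / 3 * (7 * b n + 5 * b (n - 1) + b (n - 2))) * ‖e (n + 1)‖
        + (‖r (n + 1)‖ + 4 / 3 * ‖r n‖ + 1 / 3 * ‖r (n - 1)‖) * ‖e (n + 1)‖
        ≤ 5 * ξ * ‖e (n + 1)‖ := by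
      rw [← add_mul]
      refine mul_le_mul_of_nonneg_right ?_ (norm_nonneg _)
      simp only [hξ, hx]
      linarith
    have u2 : ‖g (n + 1)‖ * ‖r (n + 1)‖ ≤ ‖g (n + 1)‖ * (3 / 2 * ξ) := by
      refine mul_le_mul_of_nonneg_left ?_ (norm_nonneg _)
      simp only [hξ, hx]
      linarith
    have u3 : c (n + 1) * ‖de (n + 1)‖ ≤ 1 / 2 * (c (n + 1) ^ 2 + ‖de (n + 1)‖ ^ 2) := by
      nlinarith [sq_nonneg (c (n + 1) - ‖de (n + 1)‖)]
    have u3' := mul_le_mul_of_nonneg_left u3 (by positivity : 0 ≤ ν * τ)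
    have hkT : T / τ = 1 / (2 * k) := by rw [hk]; field_simp
    have y1 := young_absorb hk0 ξ ‖e (n + 1)‖ ‖g (n + 1)‖
    have z2 : ξ ^ 2 ≤ 4 * (x (n + 1) ^ 2 + x n ^ 2 + x (n - 1) ^ 2 + x (n - 2) ^ 2) :=
      add_four_sq_le _ _ _ _
    have z1 : 70 * (ξ ^ 2 / k) = 140 * (T / τ) * ξ ^ 2 := by rw [hkT]; field_simp; ring
    have z3 := mul_le_mul_of_nonneg_left z2 (by positivity : 0 ≤ 140 * (T / τ))
    have z4 := mul_le_mul_of_nonneg_left hEn hk0.le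
    change E (n + 1) ≤ E n + _ + _ + _ at hs
    simp only [hF]
    clear_value E ξ k x P
    clear hEge hrD hrg hsat he0 hg0 hproj hmom hT hN d0 d1 d2 z2 u3 hkT
    linarith
  have hkN : k * N ≤ 1 / 2 := by
    rw [hk, div_mul_eq_mul_div, div_le_div_iff₀ (by positivity) (by norm_num)]
    linarith
  have hE2 : E 2 = 0 := by
    simp only [hE, energy]
    rw [he0 2 le_rfl hN2, he0 (2 - 1) (by norm_num) (by omega), hg0 2 le_rfl hN2]
    simp
  obtain ⟨r1, r2⟩ := implicit_recursion_bound (E := E)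
    (d := fun n => 1 / 2 * (ν * τ) * ‖de n‖ ^ 2) (F := F)
    (fun n => energy_nonneg _ _ _) (fun n => by positivity) (fun n => by simp only [hF]; positivity)
    hk0.le hkN hE2 hstep
  -- The constant is `4480 = 2 * 140 * 4 * 4`: the recursion bound, Young's inequality with `70 / k
  -- = 140 T / τ`, the square of a sum of four terms, and four shifted sums.
  have hFS : 2 * ∑ n ∈ Finset.Ico 2 N, F n ≤
      4480 * (T / τ) * ∑ j ∈ Finset.range (N + 1), (a j + b j) ^ 2
          + ν * τ * ∑ j ∈ Finset.range (N + 1), c j ^ 2 := by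
    have hx2 : ∀ n, 0 ≤ x n ^ 2 := fun n => sq_nonneg _
    have s0 := sum_shift_le hx2 N (k := 0) (by norm_num)
    have s1 := sum_shift_le hx2 N (k := 1) (by norm_num)
    have s2 := sum_shift_le hx2 N (k := 2) (by norm_num)
    have s3 := sum_shift_le hx2 N (k := 3) (by norm_num)
    have t0 := sum_shift_le (fun n => sq_nonneg (c n)) N (k := 0) (by norm_num)
    simp only [Nat.reduceSubDiff, Nat.sub_zero, Nat.add_sub_cancel] at s0 s1 s2 s3 t0
    have hsum : ∑ n ∈ Finset.Ico 2 N, (x (n + 1) ^ 2 + x n ^ 2 + x (n - 1) ^ 2 + x (n - 2) ^ 2)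
        ≤ 4 * ∑ j ∈ Finset.range (N + 1), x j ^ 2 := by
      rw [Finset.sum_add_distrib, Finset.sum_add_distrib, Finset.sum_add_distrib]
      linarith
    simp only [hF]
    rw [Finset.sum_add_distrib, ← Finset.mul_sum, ← Finset.mul_sum, ← Finset.mul_sum]
    have v1 := mul_le_mul_of_nonneg_left hsum (by positivity : 0 ≤ T / τ)
    have v2 := mul_le_mul_of_nonneg_left t0 (by positivity : 0 ≤ ν * τ)
    linarith
  refine ⟨fun n h2 hn => ((hEge n hn).trans (r1 n h2 hn)).trans hFS, ?_⟩
  rw [Finset.mul_sum]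
  exact r2.trans hFS

end Energy

/-! ### The truncation error of the proper orthogonal decomposition -/

section POD

variable {V : Type*} [AddCommGroup V] [Module ℝ V]

theorem podMode_mem_podSpace (N : ℕ) (s : ℕ → V) (lam : Fin (N + 1) → ℝ)
    (w : Fin (N + 1) → EuclideanSpace ℝ (Fin (N + 1))) {r : ℕ} {i : Fin (N + 1)} (hi : (i : ℕ) < r) :
    podMode N s lam w i ∈ podSpace N s lam w r :=
  Submodule.subset_span ⟨i, hi, rfl⟩

theorem podSpace_le {N : ℕ} {s : ℕ → V} (lam : Fin (N + 1) → ℝ)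
    (w : Fin (N + 1) → EuclideanSpace ℝ (Fin (N + 1))) (r : ℕ) {M : Submodule ℝ V}
    (hM : ∀ n ≤ N, s n ∈ M) : podSpace N s lam w r ≤ M := by
  refine Submodule.span_le.2 ?_
  rintro _ ⟨i, -, rfl⟩
  exact M.smul_mem _ (M.sum_mem fun k _ => M.smul_mem _ (hM _ (by omega)))

instance podSpace_finiteDimensional (N : ℕ) (s : ℕ → V) (lam : Fin (N + 1) → ℝ)
    (w : Fin (N + 1) → EuclideanSpace ℝ (Fin (N + 1))) (r : ℕ) :
    FiniteDimensional ℝ (podSpace N s lam w r) := by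
  refine FiniteDimensional.span_of_finite ℝ ?_
  refine (Set.finite_range (podMode N s lam w)).subset ?_
  rintro _ ⟨i, -, rfl⟩
  exact ⟨i, rfl⟩

/-- The unnormalized POD mode. -/
def rawMode (N : ℕ) (s : ℕ → V) (w : Fin (N + 1) → EuclideanSpace ℝ (Fin (N + 1)))
    (i : Fin (N + 1)) : V :=
  ∑ k, w i k • s k

/-- The truncated POD expansion of the `n`-th snapshot. -/
def podTrunc (N : ℕ) (s : ℕ → V) (lam : Fin (N + 1) → ℝ)
    (w : Fin (N + 1) → EuclideanSpace ℝ (Fin (N + 1))) (r n : ℕ) : V :=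
  ∑ i ∈ Finset.univ.filter (fun i : Fin (N + 1) => (i : ℕ) < r),
    (w i (Fin.ofNat (N + 1) n) * Real.sqrt (((N : ℝ) + 1) * lam i)) • podMode N s lam w i

theorem podTrunc_mem (N : ℕ) (s : ℕ → V) (lam : Fin (N + 1) → ℝ)
    (w : Fin (N + 1) → EuclideanSpace ℝ (Fin (N + 1))) (r n : ℕ) :
    podTrunc N s lam w r n ∈ podSpace N s lam w r :=
  Submodule.sum_mem _ fun _ hi => Submodule.smul_mem _ _
    (podMode_mem_podSpace N s lam w (Finset.mem_filter.1 hi).2)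

variable {B : LinearMap.BilinForm ℝ V} {N : ℕ} {s : ℕ → V} {lam : Fin (N + 1) → ℝ}
  {w : Fin (N + 1) → EuclideanSpace ℝ (Fin (N + 1))}

theorem IsPODSystem.sum_mul_row (h : IsPODSystem (fun u v => B u v) N s lam w)
    (i j : Fin (N + 1)) : ∑ k, w i k * w j k = if i = j then 1 else 0 := by
  have := orthonormal_iff_ite.1 h.orthonormal i j
  rw [← this, PiLp.inner_apply]
  simp [mul_comm]

/-- There are as many eigenvectors as coordinates, so orthonormal rows force orthonormal columns. -/
theorem IsPODSystem.sum_mul_col (h : IsPODSystem (fun u v => B u v) N s lam w)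
    (k l : Fin (N + 1)) : ∑ i, w i k * w i l = if k = l then 1 else 0 := by
  set W : Matrix (Fin (N + 1)) (Fin (N + 1)) ℝ := Matrix.of fun i k => w i k with hW
  have h1 : W * W.transpose = 1 := by
    ext i j
    simp [Matrix.mul_apply, hW, h.sum_mul_row, Matrix.one_apply]
  have h2 := congrArg (fun A => A k l) (mul_eq_one_comm.1 h1)
  simpa [Matrix.mul_apply, hW, Matrix.one_apply] using h2

/-- Only the orthogonality of the matrix of eigenvectors is used, so the expansion is exact even
when some eigenvalues vanish. -/
theorem IsPODSystem.snapshot_eq (h : IsPODSystem (fun u v => B u v) N s lam w)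
    (k : Fin (N + 1)) : s k = ∑ i, w i k • rawMode N s w i := by
  simp only [rawMode, Finset.smul_sum, smul_smul]
  rw [Finset.sum_comm]
  simp only [← Finset.sum_smul, h.sum_mul_col]
  simp

theorem IsPODSystem.form_snapshot (h : IsPODSystem (fun u v => B u v) N s lam w)
    (k j : Fin (N + 1)) : B (s k) (rawMode N s w j) = ((N : ℝ) + 1) * lam j * w j k := by
  have hN : ((N : ℝ) + 1) ≠ 0 := by positivity
  have := h.eigen j k
  simp only [correlation, Matrix.of_apply] at this
  rw [mul_assoc, ← this, Finset.mul_sum]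
  simp only [rawMode, map_sum, map_smul, smul_eq_mul]
  refine Finset.sum_congr rfl fun l _ => ?_
  field_simp

theorem IsPODSystem.form_rawMode (h : IsPODSystem (fun u v => B u v) N s lam w)
    (i j : Fin (N + 1)) :
    B (rawMode N s w i) (rawMode N s w j) = if i = j then ((N : ℝ) + 1) * lam i else 0 := by
  have h2 : B (rawMode N s w i) (rawMode N s w j)
      = ((N : ℝ) + 1) * lam j * ∑ k, w i k * w j k := by
    conv_lhs => rw [rawMode, map_sum, LinearMap.sum_apply]
    rw [Finset.mul_sum]
    refine Finset.sum_congr rfl fun k _ => ?_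
    rw [map_smul, LinearMap.smul_apply, h.form_snapshot, smul_eq_mul]
    ring
  rw [h2, h.sum_mul_row]
  split_ifs with hij
  · rw [hij, mul_one]
  · simp

theorem IsPODSystem.eigenvalue_nonneg (h : IsPODSystem (fun u v => B u v) N s lam w)
    (hB : ∀ v, 0 ≤ B v v) (i : Fin (N + 1)) : 0 ≤ lam i := by
  have h1 := hB (rawMode N s w i)
  rw [h.form_rawMode, if_pos rfl] at h1
  exact nonneg_of_mul_nonneg_right h1 (by positivity)

theorem podMode_eq_rawMode (i : Fin (N + 1)) :
    podMode N s lam w i = (1 / Real.sqrt (((N : ℝ) + 1) * lam i)) • rawMode N s w i := rfl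

theorem rawMode_mem {M : Submodule ℝ V} (hM : ∀ n ≤ N, s n ∈ M) (i : Fin (N + 1)) :
    rawMode N s w i ∈ M :=
  M.sum_mem fun k _ => M.smul_mem _ (hM _ (by omega))

variable {X : Type*} [NormedAddCommGroup X] [InnerProductSpace ℝ X]

/-- Undoing the normalization fails only for a zero eigenvalue. In that case the raw mode has zero
`B`-length, so `L` kills it, and the right side vanishes too. -/
theorem IsPODSystem.map_rawMode (h : IsPODSystem (fun u v => B u v) N s lam w)
    (hB : ∀ v, 0 ≤ B v v) {M : Submodule ℝ V} (hM : ∀ n ≤ N, s n ∈ M) {L : V →ₗ[ℝ] X}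
    (hL : ∀ v ∈ M, B v v = 0 → L v = 0) (i : Fin (N + 1)) :
    L (rawMode N s w i) = Real.sqrt (((N : ℝ) + 1) * lam i) • L (podMode N s lam w i) := by
  rw [podMode_eq_rawMode, map_smul, smul_smul]
  rcases (h.eigenvalue_nonneg hB i).eq_or_lt with h0 | h0
  · rw [hL _ (rawMode_mem hM i) (by rw [h.form_rawMode, if_pos rfl, ← h0, mul_zero]), smul_zero]
  · have : Real.sqrt (((N : ℝ) + 1) * lam i) ≠ 0 := by positivity
    rw [mul_one_div_cancel this, one_smul]

theorem IsPODSystem.map_snapshot_sub (h : IsPODSystem (fun u v => B u v) N s lam w)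
    (hB : ∀ v, 0 ≤ B v v) {M : Submodule ℝ V} (hM : ∀ n ≤ N, s n ∈ M) {L : V →ₗ[ℝ] X}
    (hL : ∀ v ∈ M, B v v = 0 → L v = 0) (r : ℕ) (k : Fin (N + 1)) :
    L (s k) - L (podTrunc N s lam w r k) = ∑ i ∈ Finset.univ.filter (fun i : Fin (N + 1) => r ≤ (i : ℕ)),
      w i k • L (rawMode N s w i) := by
  have h1 : L (podTrunc N s lam w r k)
      = ∑ i ∈ Finset.univ.filter (fun i : Fin (N + 1) => (i : ℕ) < r), w i k • L (rawMode N s w i) := by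
    simp only [podTrunc, map_sum, map_smul]
    refine Finset.sum_congr rfl fun i _ => ?_
    rw [h.map_rawMode hB hM hL, smul_smul]
    have : (Fin.ofNat (N + 1) (k : ℕ) : Fin (N + 1)) = k := by
      ext
      simp [Fin.ofNat, Nat.mod_eq_of_lt k.2]
    rw [this]
  have h2 : L (s k) = ∑ i, w i k • L (rawMode N s w i) := by
    conv_lhs => rw [h.snapshot_eq k]
    simp only [map_sum, map_smul]
  rw [h1, h2, ← Finset.sum_filter_add_sum_filter_not Finset.univ
    (fun i : Fin (N + 1) => (i : ℕ) < r)]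
  simp only [not_lt, add_sub_cancel_left]

/-- The mean square truncation error, in any seminorm, is the weighted tail sum of the modes. -/
theorem IsPODSystem.sum_norm_sq_sub (h : IsPODSystem (fun u v => B u v) N s lam w)
    (hB : ∀ v, 0 ≤ B v v) {M : Submodule ℝ V} (hM : ∀ n ≤ N, s n ∈ M) {L : V →ₗ[ℝ] X}
    (hL : ∀ v ∈ M, B v v = 0 → L v = 0) (r : ℕ) :
    ∑ n ∈ Finset.range (N + 1), ‖L (podTrunc N s lam w r n) - L (s n)‖ ^ 2 =
      ((N : ℝ) + 1) * ∑ i ∈ Finset.univ.filter (fun i : Fin (N + 1) => r ≤ (i : ℕ)),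
        lam i * ‖L (podMode N s lam w i)‖ ^ 2 := by
  rw [Finset.sum_range]
  have h1 : ∀ k : Fin (N + 1), ‖L (podTrunc N s lam w r k) - L (s k)‖ ^ 2 =
      ∑ i ∈ Finset.univ.filter (fun i : Fin (N + 1) => r ≤ (i : ℕ)), ∑ j ∈ Finset.univ.filter (fun j : Fin (N + 1) => r ≤ (j : ℕ)),
        w i k * w j k * inner ℝ (L (rawMode N s w i)) (L (rawMode N s w j)) := by
    intro k
    rw [norm_sub_rev, h.map_snapshot_sub hB hM hL, ← real_inner_self_eq_norm_sq, sum_inner]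
    refine Finset.sum_congr rfl fun i _ => ?_
    rw [inner_sum]
    refine Finset.sum_congr rfl fun j _ => ?_
    rw [real_inner_smul_left, real_inner_smul_right, mul_assoc]
  simp only [h1]
  rw [Finset.sum_comm, Finset.mul_sum]
  refine Finset.sum_congr rfl fun i hi => ?_
  -- Summing over the snapshots removes the cross terms through the orthonormality of `w`; the modes
  -- need not be orthogonal after applying `L`.
  rw [Finset.sum_comm]
  simp only [← Finset.sum_mul, h.sum_mul_row]
  simp only [ite_mul, one_mul, zero_mul]
  rw [Finset.sum_ite_eq, if_pos hi, real_inner_self_eq_norm_sq, h.map_rawMode hB hM hL, norm_smul,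
    mul_pow, Real.norm_eq_abs, sq_abs, Real.sq_sqrt]
  · ring
  · have := h.eigenvalue_nonneg hB i
    positivity

/-- The orthogonal projection of a snapshot is its truncated expansion, up to elements of
zero length. -/
theorem IsPODSystem.map_projection_eq (h : IsPODSystem (fun u v => B u v) N s lam w)
    (hB : ∀ v, 0 ≤ B v v) {M : Submodule ℝ V} (hM : ∀ n ≤ N, s n ∈ M) {L : V →ₗ[ℝ] X}
    (hL : ∀ v ∈ M, B v v = 0 → L v = 0) {r n : ℕ} (hn : n ≤ N) {y : V}
    (hy : IsProjection (fun u v => B u v) (podSpace N s lam w r) (s n) y) :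
    L y = L (podTrunc N s lam w r n) := by
  set P := podTrunc N s lam w r n with hP
  -- The truncation has the defining property of the projection. By linearity it suffices to test
  -- with the modes, where only the coefficient of the same index survives.
  have hort : ∀ v ∈ podSpace N s lam w r, B (s n - P) v = 0 := by
    intro v hv
    induction hv using Submodule.span_induction with
    | zero => exact map_zero _
    | add x y _ _ hx hy => rw [map_add, hx, hy, add_zero]
    | smul c x _ hx => rw [map_smul, hx, smul_zero]
    | mem v hv =>
      obtain ⟨j, hj, rfl⟩ := hv
      have hsn : s n = s ((Fin.ofNat (N + 1) n : Fin (N + 1)) : ℕ) := by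
        simp [Fin.ofNat, Nat.mod_eq_of_lt (Nat.lt_succ_of_le hn)]
      have e1 : B P (podMode N s lam w j) = w j (Fin.ofNat (N + 1) n) *
          Real.sqrt (((N : ℝ) + 1) * lam j) * (1 / Real.sqrt (((N : ℝ) + 1) * lam j)) *
          (1 / Real.sqrt (((N : ℝ) + 1) * lam j)) * (((N : ℝ) + 1) * lam j) := by
        rw [hP, podTrunc, map_sum, LinearMap.sum_apply, Finset.sum_eq_single j]
        · simp only [podMode_eq_rawMode, map_smul, LinearMap.smul_apply, smul_eq_mul,
            h.form_rawMode, if_true]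
          ring
        · intro i _ hij
          simp only [podMode_eq_rawMode, map_smul, LinearMap.smul_apply, smul_eq_mul,
            h.form_rawMode, if_neg hij, mul_zero]
        · intro hj'
          exact absurd (Finset.mem_filter.2 ⟨Finset.mem_univ j, hj⟩) hj'
      rw [map_sub, LinearMap.sub_apply, e1, hsn, podMode_eq_rawMode, map_smul, h.form_snapshot,
        smul_eq_mul]
      rcases (h.eigenvalue_nonneg hB j).eq_or_lt with h0 | h0
      · simp [← h0]
      · have : Real.sqrt (((N : ℝ) + 1) * lam j) ≠ 0 := by positivity
        field_simp
        ring
  have hd : y - P ∈ podSpace N s lam w r := Submodule.sub_mem _ hy.1 (podTrunc_mem N s lam w r n)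
  -- Two `B`-orthogonal projections of the same snapshot differ by an element of the reduced space
  -- orthogonal to that space, hence `B`-null.
  have h0 : B (y - P) (y - P) = 0 := by
    have e1 : y - P = (s n - P) - (s n - y) := by abel
    have e2 : B (s n - y) (y - P) = 0 := hy.2 _ hd
    conv_lhs => rw [e1]
    rw [map_sub B, LinearMap.sub_apply, ← e1, hort _ hd, e2, sub_zero]
  have := hL _ (podSpace_le lam w r hM hd) h0
  rwa [map_sub, sub_eq_zero] at this

end POD

/-! ### Sobolev and finite element spaces -/

variable {Ω : Set Plane}

theorem inner_toLp_eq_integral {f g : Plane → ℝ} (hf : MemLp f 2 (volume.restrict Ω))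
    (hg : MemLp g 2 (volume.restrict Ω)) :
    inner ℝ (hf.toLp f) (hg.toLp g) = ∫ x in Ω, f x * g x := by
  rw [L2.inner_def]
  refine integral_congr_ae ?_
  filter_upwards [hf.coeFn_toLp, hg.coeFn_toLp] with x h1 h2
  rw [h1, h2]
  simp [mul_comm]

theorem TestFn.eq_zero_of_notMem (φ : TestFn Ω) {x : Plane} (hx : x ∉ Ω) : φ.toFun x = 0 :=
  image_eq_zero_of_notMem_tsupport fun h => hx (φ.supp_subset h)

theorem TestFn.inner_val_toLp (φ : TestFn Ω) {g : Plane → ℝ}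
    (hg : MemLp g 2 (volume.restrict Ω)) :
    inner ℝ φ.val (hg.toLp g) = ∫ x, φ.toFun x * g x := by
  rw [TestFn.val, inner_toLp_eq_integral]
  exact setIntegral_eq_integral_of_forall_compl_eq_zero fun x hx => by
    rw [φ.eq_zero_of_notMem hx, zero_mul]

theorem TestFn.continuous_pderiv (φ : TestFn Ω) (i : Fin 2) : Continuous (pderiv i φ.toFun) :=
  (φ.smooth.continuous_fderiv (by simp)).clm_apply continuous_const

theorem TestFn.differentiable (φ : TestFn Ω) : Differentiable ℝ φ.toFun :=
  φ.smooth.differentiable (by simp)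

theorem TestFn.mem_H1 (φ : TestFn Ω) : (φ.val, φ.grad) ∈ H1 Ω := by
  intro ψ i
  have h1 : inner ℝ φ.val (ψ.grad i) = ∫ x, φ.toFun x * pderiv i ψ.toFun x :=
    φ.inner_val_toLp (ψ.pderiv_memLp i)
  have h2 : inner ℝ (φ.grad i) ψ.val = ∫ x, pderiv i φ.toFun x * ψ.toFun x := by
    rw [real_inner_comm]
    refine (ψ.inner_val_toLp (φ.pderiv_memLp i)).trans ?_
    simp only [mul_comm]
  change inner ℝ φ.val (ψ.grad i) = - inner ℝ (φ.grad i) ψ.val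
  rw [h1, h2]
  refine integral_mul_fderiv_eq_neg_fderiv_mul_of_integrable ?_ ?_ ?_
    (fun x _ => φ.differentiable x) (fun x _ => ψ.differentiable x)
  · exact ((φ.continuous_pderiv i).mul ψ.smooth.continuous).integrable_of_hasCompactSupport
      ψ.compact_supp.mul_left
  · exact (φ.smooth.continuous.mul (ψ.continuous_pderiv i)).integrable_of_hasCompactSupport
      φ.compact_supp.mul_right
  · exact (φ.smooth.continuous.mul ψ.smooth.continuous).integrable_of_hasCompactSupport
      φ.compact_supp.mul_right

theorem TestFn.toLp_eq {f g : Plane → ℝ} (hf : MemLp f 2 (volume.restrict Ω))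
    (hg : MemLp g 2 (volume.restrict Ω)) (h : ∀ x, f x = g x) : hf.toLp f = hg.toLp g :=
  MemLp.toLp_congr hf hg (Filter.Eventually.of_forall h)

/-- Test functions already form a linear space, so passing to the span adds nothing; closure
arguments on `H10` can start from a single test function. -/
theorem exists_testFn_eq {u : Scalar Ω}
    (hu : u ∈ Submodule.span ℝ (Set.range fun φ : TestFn Ω => (φ.val, φ.grad))) :
    ∃ φ : TestFn Ω, u = (φ.val, φ.grad) := by
  induction hu using Submodule.span_induction with
  | mem x hx =>
    obtain ⟨φ, rfl⟩ := hx
    exact ⟨φ, rfl⟩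
  | zero =>
    set ζ : TestFn Ω := ⟨fun _ => 0, contDiff_const, HasCompactSupport.zero, by simp [tsupport]⟩
    refine ⟨ζ, ?_⟩
    refine Prod.ext ?_ ?_
    · exact (MemLp.toLp_zero (MemLp.zero (ε := ℝ))).symm
    · ext1 i
      exact (MemLp.toLp_zero (MemLp.zero (ε := ℝ))).symm.trans
        (TestFn.toLp_eq _ (ζ.pderiv_memLp i) fun x => by simp [ζ, pderiv])
  | add u v _ _ hu hv =>
    obtain ⟨φ, rfl⟩ := hu
    obtain ⟨ψ, rfl⟩ := hv
    refine ⟨⟨φ.toFun + ψ.toFun, φ.smooth.add ψ.smooth, φ.compact_supp.add ψ.compact_supp,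
      (tsupport_add _ _).trans (Set.union_subset φ.supp_subset ψ.supp_subset)⟩, ?_⟩
    refine Prod.ext ?_ ?_
    · exact (MemLp.toLp_add φ.memLp ψ.memLp).symm
    · ext1 i
      refine (MemLp.toLp_add (φ.pderiv_memLp i) (ψ.pderiv_memLp i)).symm.trans
        (TestFn.toLp_eq _ (TestFn.pderiv_memLp _ i) fun x => ?_)
      simp [pderiv, fderiv_add (φ.differentiable x) (ψ.differentiable x)]
  | smul c u _ hu =>
    obtain ⟨φ, rfl⟩ := hu
    refine ⟨⟨c • φ.toFun, φ.smooth.const_smul c, φ.compact_supp.smul_left (f := fun _ => c),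
      (closure_mono (Function.support_const_smul_subset c _)).trans φ.supp_subset⟩, ?_⟩
    refine Prod.ext ?_ ?_
    · exact (MemLp.toLp_const_smul c φ.memLp).symm
    · ext1 i
      refine (MemLp.toLp_const_smul c (φ.pderiv_memLp i)).symm.trans
        (TestFn.toLp_eq _ (TestFn.pderiv_memLp _ i) fun x => ?_)
      simp [pderiv, fderiv_const_smul (φ.differentiable x)]

/-- A closed condition that holds for test functions holds on `H¹₀`. -/
theorem H10_induction {p : Scalar Ω → Prop} (hclosed : IsClosed {v | p v})
    (htest : ∀ φ : TestFn Ω, p (φ.val, φ.grad)) {v : Scalar Ω} (hv : v ∈ H10 Ω) : p v := by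
  refine closure_minimal (s := ((Submodule.span ℝ (Set.range fun φ : TestFn Ω =>
    (φ.val, φ.grad)) : Submodule ℝ (Scalar Ω)) : Set (Scalar Ω))) (t := {v | p v}) ?_ hclosed hv
  intro u hu
  obtain ⟨φ, rfl⟩ := exists_testFn_eq hu
  exact htest φ

theorem continuous_snd_apply (i : Fin 2) : Continuous fun v : Scalar Ω => v.2 i :=
  (PiLp.continuous_apply 2 (fun _ : Fin 2 => L2 Ω) i).comp continuous_snd

/-- Integration by parts between `H¹` and `H¹₀`. -/
theorem inner_snd_eq_neg {q v : Scalar Ω} (hq : q ∈ H1 Ω) (hv : v ∈ H10 Ω) (i : Fin 2) :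
    inner ℝ q.1 (v.2 i) = - inner ℝ (q.2 i) v.1 :=
  H10_induction (p := fun v : Scalar Ω => inner ℝ q.1 (v.2 i) = - inner ℝ (q.2 i) v.1)
    (isClosed_eq (continuous_const.inner (continuous_snd_apply i))
      (continuous_const.inner continuous_fst).neg) (fun φ => hq φ i) hv

/-- The integration by parts formula is symmetric: use the test function as the `H1` factor. -/
theorem H10_le_H1 : H10 Ω ≤ H1 Ω := by
  intro v hv φ i
  have := inner_snd_eq_neg φ.mem_H1 hv i
  simp only at this
  rw [real_inner_comm, real_inner_comm φ.val, this, neg_neg, real_inner_comm]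

theorem integrable_coe (hΩ : Bornology.IsBounded Ω) (q : L2 Ω) : IntegrableOn q Ω := by
  have : IsFiniteMeasure (volume.restrict Ω) := ⟨by simpa using hΩ.measure_lt_top⟩
  exact (Lp.memLp q).integrable (by norm_num)

/-- The weak gradient of the zero function vanishes. -/
theorem snd_eq_zero_of_fst_eq_zero (hΩ : IsOpen Ω) (hb : Bornology.IsBounded Ω) {q : Scalar Ω}
    (hq : q ∈ H1 Ω) (h : q.1 = 0) : q.2 = 0 := by
  ext1 i
  have hloc : LocallyIntegrableOn (q.2 i : Plane → ℝ) Ω :=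
    (integrable_coe hb (q.2 i)).locallyIntegrableOn
  -- Fundamental lemma of the calculus of variations: the weak derivative is orthogonal to every
  -- test function.
  have key := hΩ.ae_eq_zero_of_integral_contDiff_smul_eq_zero hloc (fun g hg hc hs => by
    set φ : TestFn Ω := ⟨g, hg, hc, hs⟩
    have h1 := hq φ i
    rw [h, inner_zero_left, eq_comm, neg_eq_zero, real_inner_comm] at h1
    have h2 := φ.inner_val_toLp (Lp.memLp (q.2 i))
    rw [Lp.toLp_coeFn, h1] at h2
    exact h2.symm)
  refine Lp.ext ?_
  filter_upwards [(ae_restrict_iff' hΩ.measurableSet).2 key, Lp.coeFn_zero ℝ 2 (volume.restrict Ω)]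
    with x h1 h2
  rw [h1]
  exact h2.symm

/-- Integrating `x₀ ∂₀(φ²)` by parts gives `‖φ‖² = -2 (x₀ φ, ∂₀ φ)`. Cauchy–Schwarz and `|x₀| ≤ R`
on `Ω` then allow division by `‖φ‖`. -/
theorem TestFn.norm_val_le (φ : TestFn Ω) {R : ℝ} (hR0 : 0 ≤ R) (hR : ∀ x ∈ Ω, ‖x‖ ≤ R) :
    ‖φ.val‖ ≤ 2 * R * ‖φ.grad‖ := by
  have hc : ContDiff ℝ ∞ fun x : Plane => x 0 := by fun_prop
  set χ : TestFn Ω := ⟨fun x => x 0 * φ.toFun x, hc.mul φ.smooth, φ.compact_supp.mul_left,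
    (closure_mono (Function.support_mul_subset_right _ _)).trans φ.supp_subset⟩ with hχ
  have hparts : ∫ x : Plane, x 0 * (2 * φ.toFun x * pderiv 0 φ.toFun x)
      = - ∫ x : Plane, φ.toFun x * φ.toFun x := by
    have hd : ∀ x : Plane, fderiv ℝ (fun y => φ.toFun y ^ 2) x (EuclideanSpace.single 0 1)
        = 2 * φ.toFun x * pderiv 0 φ.toFun x := by
      intro x
      rw [fderiv_fun_pow 2 (φ.differentiable x)]
      simp [pderiv]
    have hd' : ∀ x : Plane, fderiv ℝ (fun y : Plane => y 0) x (EuclideanSpace.single 0 1) = 1 := by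
      intro x
      have : HasFDerivAt (fun y : Plane => y 0) (EuclideanSpace.proj (𝕜 := ℝ) (0 : Fin 2)) x :=
        (EuclideanSpace.proj (𝕜 := ℝ) (0 : Fin 2)).hasFDerivAt
      rw [this.fderiv]
      simp
    have hcs : HasCompactSupport fun x => φ.toFun x ^ 2 :=
      φ.compact_supp.comp_left (g := fun t : ℝ => t ^ 2) (by norm_num)
    have := integral_mul_fderiv_eq_neg_fderiv_mul_of_integrable (μ := (volume : Measure Plane))
      (f := fun y : Plane => y 0) (g := fun y => φ.toFun y ^ 2) (v := EuclideanSpace.single 0 1)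
      ?_ ?_ ?_ (fun x _ => (hc.differentiable (by simp)) x) (fun x _ => (φ.differentiable x).pow 2)
    · simp only [hd, hd'] at this
      rw [this]
      simp only [one_mul, sq]
    · simp only [hd', one_mul]
      exact (φ.smooth.continuous.pow 2).integrable_of_hasCompactSupport hcs
    · simp only [hd]
      refine (hc.continuous.mul ((continuous_const.mul φ.smooth.continuous).mul
        (φ.continuous_pderiv 0))).integrable_of_hasCompactSupport ?_
      exact (φ.compact_supp.mul_left.mul_right).mul_left
    · exact (hc.continuous.mul (φ.smooth.continuous.pow 2)).integrable_of_hasCompactSupport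
        hcs.mul_left
  have h1 : inner ℝ χ.val (φ.grad 0) = ∫ x : Plane, x 0 * φ.toFun x * pderiv 0 φ.toFun x :=
    χ.inner_val_toLp (φ.pderiv_memLp 0)
  have h2 : ‖φ.val‖ ^ 2 = ∫ x : Plane, φ.toFun x * φ.toFun x := by
    rw [← real_inner_self_eq_norm_sq]
    exact φ.inner_val_toLp φ.memLp
  have h3 : ‖φ.val‖ ^ 2 = - 2 * inner ℝ χ.val (φ.grad 0) := by
    rw [h2, h1, ← neg_eq_iff_eq_neg.2 hparts, ← integral_const_mul, ← integral_neg]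
    congr 1
    ext x
    ring
  have h4 : ‖χ.val‖ ≤ R * ‖φ.val‖ := by
    refine Lp.norm_le_mul_norm_of_ae_le_mul ?_
    have hΩae : ∀ᵐ x ∂(volume.restrict Ω), φ.toFun x ≠ 0 → x ∈ Ω :=
      Filter.Eventually.of_forall fun x hx => by
        by_contra hn
        exact hx (φ.eq_zero_of_notMem hn)
    filter_upwards [χ.memLp.coeFn_toLp, φ.memLp.coeFn_toLp, hΩae] with x e1 e2 hx
    rw [TestFn.val, TestFn.val, e1, e2]
    change ‖x 0 * φ.toFun x‖ ≤ _
    rw [norm_mul]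
    by_cases h0 : φ.toFun x = 0
    · simp [h0]
    · exact mul_le_mul_of_nonneg_right ((PiLp.norm_apply_le x 0).trans (hR x (hx h0)))
        (norm_nonneg _)
  have h5 : ‖φ.grad 0‖ ≤ ‖φ.grad‖ := PiLp.norm_apply_le φ.grad 0
  have h6 : ‖φ.val‖ ^ 2 ≤ 2 * R * ‖φ.grad‖ * ‖φ.val‖ := by
    have := neg_le_of_abs_le (abs_real_inner_le_norm χ.val (φ.grad 0))
    have h7 : ‖χ.val‖ * ‖φ.grad 0‖ ≤ R * ‖φ.val‖ * ‖φ.grad‖ := by gcongr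
    rw [h3]
    linarith
  rcases (norm_nonneg φ.val).eq_or_lt with h0 | h0
  · rw [← h0]; positivity
  · rw [sq] at h6
    exact le_of_mul_le_mul_right h6 h0

/-- The Poincaré inequality. -/
theorem exists_norm_fst_le (hb : Bornology.IsBounded Ω) :
    ∃ C : ℝ, ∀ v ∈ H10 Ω, ‖v.1‖ ≤ C * ‖v.2‖ := by
  obtain ⟨R, hR⟩ := hb.exists_norm_le
  refine ⟨2 * max R 0, fun v hv => ?_⟩
  refine H10_induction (p := fun v : Scalar Ω => ‖v.1‖ ≤ 2 * max R 0 * ‖v.2‖)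
    (isClosed_le continuous_fst.norm (continuous_const.mul continuous_snd.norm)) (fun φ => ?_) hv
  exact φ.norm_val_le (le_max_right _ _) fun x hx => (hR x hx).trans (le_max_left _ _)

/-! ### Velocities and pressures -/

/-- The vector field underlying a velocity, as a linear map. -/
def velValₗ (Ω : Set Plane) : Vel Ω →ₗ[ℝ] L2Vec Ω where
  toFun := velVal
  map_add' _ _ := rfl
  map_smul' _ _ := rfl

/-- The gradient of a velocity, as a linear map. -/
def velGradₗ (Ω : Set Plane) : Vel Ω →ₗ[ℝ] L2Mat Ω where
  toFun := velGrad
  map_add' _ _ := rfl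
  map_smul' _ _ := rfl

/-- The weighted sum of two inner products pulled back along linear maps. -/
def pullbackForm {V X Y : Type*} [AddCommGroup V] [Module ℝ V] [NormedAddCommGroup X]
    [InnerProductSpace ℝ X] [NormedAddCommGroup Y] [InnerProductSpace ℝ Y] (a b : ℝ)
    (L₁ : V →ₗ[ℝ] X) (L₂ : V →ₗ[ℝ] Y) : LinearMap.BilinForm ℝ V :=
  LinearMap.mk₂ ℝ (fun u v => a * inner ℝ (L₁ u) (L₁ v) + b * inner ℝ (L₂ u) (L₂ v))
    (fun u v w => by simp only [map_add, inner_add_left]; ring)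
    (fun c u v => by simp only [map_smul, real_inner_smul_left, smul_eq_mul]; ring)
    (fun u v w => by simp only [map_add, inner_add_right]; ring)
    (fun c u v => by simp only [map_smul, real_inner_smul_right, smul_eq_mul]; ring)

section pullbackForm

variable {V X Y : Type*} [AddCommGroup V] [Module ℝ V] [NormedAddCommGroup X]
  [InnerProductSpace ℝ X] [NormedAddCommGroup Y] [InnerProductSpace ℝ Y] {a b : ℝ}
  {L₁ : V →ₗ[ℝ] X} {L₂ : V →ₗ[ℝ] Y}

theorem pullbackForm_self (v : V) :
    pullbackForm a b L₁ L₂ v v = a * ‖L₁ v‖ ^ 2 + b * ‖L₂ v‖ ^ 2 := by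
  simp only [pullbackForm, LinearMap.mk₂_apply, real_inner_self_eq_norm_sq]

theorem pullbackForm_self_nonneg (ha : 0 ≤ a) (hb : 0 ≤ b) (v : V) :
    0 ≤ pullbackForm a b L₁ L₂ v v := by
  rw [pullbackForm_self]; positivity

theorem pullbackForm_self_eq_zero (ha : 0 ≤ a) (hb : 0 ≤ b) (hab : 0 < a + b) {v : V}
    (h : pullbackForm a b L₁ L₂ v v = 0) : L₁ v = 0 ∨ L₂ v = 0 := by
  rw [pullbackForm_self] at h
  have h1 : 0 ≤ a * ‖L₁ v‖ ^ 2 := by positivity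
  have h2 : 0 ≤ b * ‖L₂ v‖ ^ 2 := by positivity
  rcases ha.eq_or_lt with h0 | h0
  · right
    have : b ≠ 0 := by rintro rfl; simp [← h0] at hab
    have h3 : b * ‖L₂ v‖ ^ 2 = 0 := by linarith
    simpa [this] using h3
  · left
    have h3 : a * ‖L₁ v‖ ^ 2 = 0 := by linarith
    simpa [h0.ne'] using h3

end pullbackForm

/-- One direction is uniqueness of the weak gradient, the other the Poincaré inequality. This makes
the choice of weights in the velocity inner product immaterial. -/
theorem velVal_eq_zero_iff (hΩ : IsOpen Ω) (hb : Bornology.IsBounded Ω) {v : Vel Ω}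
    (hv : ∀ i, v i ∈ H10 Ω) : velVal v = 0 ↔ velGrad v = 0 := by
  constructor
  · intro h
    ext1 i
    exact snd_eq_zero_of_fst_eq_zero hΩ hb (H10_le_H1 (hv i)) (congrArg (fun u : L2Vec Ω => u i) h)
  · intro h
    obtain ⟨C, hC⟩ := exists_norm_fst_le hb
    ext1 i
    have h1 := hC _ (hv i)
    have h2 : (v i).2 = 0 := congrArg (fun u : L2Mat Ω => u i) h
    rw [h2, norm_zero, mul_zero] at h1
    exact norm_le_zero_iff.1 h1

theorem inner_velDiv_eq_neg {q : Scalar Ω} {v : Vel Ω} (hq : q ∈ H1 Ω) (hv : ∀ i, v i ∈ H10 Ω) :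
    inner ℝ q.1 (velDiv v) = - inner ℝ q.2 (velVal v) := by
  rw [velDiv, inner_sum, PiLp.inner_apply, ← Finset.sum_neg_distrib]
  exact Finset.sum_congr rfl fun i _ => inner_snd_eq_neg hq (hv i) i

/-- The velocity space as a submodule. -/
def velocitySubmodule (Ω : Set Plane) (𝒯 : Set (Finset Plane)) : Submodule ℝ (Vel Ω) where
  carrier := velocitySpace Ω 𝒯
  zero_mem' := fun i => ⟨zero_mem _, 0, continuousOn_const, Lp.coeFn_zero ℝ 2 _,
    fun s _ => ⟨0, by simp, fun x _ => by simp⟩⟩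
  add_mem' := by
    intro u v hu hv i
    obtain ⟨hu1, g, hg, hug, hP⟩ := hu i
    obtain ⟨hv1, k, hk, hvk, hQ⟩ := hv i
    refine ⟨add_mem hu1 hv1, g + k, hg.add hk, ?_, fun s hs => ?_⟩
    · filter_upwards [Lp.coeFn_add (u i).1 (v i).1, hug, hvk] with x h1 h2 h3
      exact h1.trans (congrArg₂ (· + ·) h2 h3)
    · obtain ⟨P, hP1, hP2⟩ := hP s hs
      obtain ⟨Q, hQ1, hQ2⟩ := hQ s hs
      refine ⟨P + Q, (MvPolynomial.totalDegree_add P Q).trans (max_le hP1 hQ1), fun x hx => ?_⟩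
      rw [map_add, ← hP2 x hx, ← hQ2 x hx, Pi.add_apply]
  smul_mem' := by
    intro c u hu i
    obtain ⟨hu1, g, hg, hug, hP⟩ := hu i
    refine ⟨Submodule.smul_mem _ c hu1, c • g, hg.const_smul c, ?_, fun s hs => ?_⟩
    · filter_upwards [Lp.coeFn_smul c (u i).1, hug] with x h1 h2
      exact h1.trans (congrArg (c • ·) h2)
    · obtain ⟨P, hP1, hP2⟩ := hP s hs
      refine ⟨c • P, (MvPolynomial.totalDegree_smul_le c P).trans hP1, fun x hx => ?_⟩
      rw [MvPolynomial.smul_eval, ← hP2 x hx, Pi.smul_apply, smul_eq_mul]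

/-- The pressure space as a submodule. -/
def pressureSubmodule (𝒯 : Set (Finset Plane)) (hb : Bornology.IsBounded Ω) :
    Submodule ℝ (Scalar Ω) where
  carrier := pressureSpace Ω 𝒯
  zero_mem' := by
    refine ⟨zero_mem _, ?_, fun s _ => ⟨0, by simp, ?_⟩⟩
    · rw [Prod.fst_zero, integral_congr_ae (Lp.coeFn_zero ℝ 2 _)]
      simp
    · filter_upwards [Lp.coeFn_zero ℝ 2 (volume.restrict Ω)] with x hx _
      exact hx.trans (by simp)
  add_mem' := by
    rintro u v ⟨hu1, hu2, hP⟩ ⟨hv1, hv2, hQ⟩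
    refine ⟨add_mem hu1 hv1, ?_, fun s hs => ?_⟩
    · rw [Prod.fst_add, integral_congr_ae (Lp.coeFn_add u.1 v.1)]
      simp only [Pi.add_apply]
      rw [integral_add (integrable_coe hb u.1) (integrable_coe hb v.1), hu2, hv2, add_zero]
    · obtain ⟨P, hP1, hP2⟩ := hP s hs
      obtain ⟨Q, hQ1, hQ2⟩ := hQ s hs
      refine ⟨P + Q, (MvPolynomial.totalDegree_add P Q).trans (max_le hP1 hQ1), ?_⟩
      filter_upwards [Lp.coeFn_add u.1 v.1, hP2, hQ2] with x h1 h2 h3 hx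
      rw [map_add, ← h2 hx, ← h3 hx]
      exact h1
  smul_mem' := by
    rintro c u ⟨hu1, hu2, hP⟩
    refine ⟨Submodule.smul_mem _ c hu1, ?_, fun s hs => ?_⟩
    · rw [Prod.smul_fst, integral_congr_ae (Lp.coeFn_smul c u.1)]
      simp only [Pi.smul_apply]
      rw [integral_smul, hu2, smul_zero]
    · obtain ⟨P, hP1, hP2⟩ := hP s hs
      refine ⟨c • P, (MvPolynomial.totalDegree_smul_le c P).trans hP1, ?_⟩
      filter_upwards [Lp.coeFn_smul c u.1, hP2] with x h1 h2 hx
      rw [MvPolynomial.smul_eval, ← h2 hx]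
      exact h1

theorem velInner_eq_pullbackForm (a b : ℝ) :
    velInner (Ω := Ω) a b = fun u v => pullbackForm a b (velValₗ Ω) (velGradₗ Ω) u v := rfl

theorem presInner_eq_pullbackForm (a b : ℝ) :
    presInner (Ω := Ω) a b = fun p q => pullbackForm a b (LinearMap.fst ℝ (L2 Ω) (L2Vec Ω))
      (LinearMap.snd ℝ (L2 Ω) (L2Vec Ω)) p q := rfl

/-! ### The error estimate -/

section Hilbert

variable {X Y : Type*} [NormedAddCommGroup X] [InnerProductSpace ℝ X] [NormedAddCommGroup Y]
  [InnerProductSpace ℝ Y]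

/-- The hypotheses say that `r` is the orthogonal projection of `ρ` onto `G`. -/
theorem norm_le_of_inner_eq {G : Submodule ℝ X} {r ρ : X} (hr : r ∈ G)
    (h : ∀ z ∈ G, inner ℝ r z = inner ℝ ρ z) : ‖r‖ ≤ ‖ρ‖ := by
  have h1 := h r hr
  rw [real_inner_self_eq_norm_sq] at h1
  have h2 := real_inner_le_norm ρ r
  rcases (norm_nonneg r).eq_or_lt with h0 | h0
  · rw [← h0]; positivity
  · rw [← h1, sq] at h2
    exact le_of_mul_le_mul_right h2 h0

theorem norm_sub_sq_le {Z : Type*} [SeminormedAddCommGroup Z] (u v w : Z) :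
    ‖u - v‖ ^ 2 ≤ 2 * ‖u - w‖ ^ 2 + 2 * ‖w - v‖ ^ 2 := by
  have h1 : ‖u - v‖ ≤ ‖u - w‖ + ‖w - v‖ := norm_sub_le_norm_sub_add_norm_sub u w v
  have h2 : ‖u - v‖ ^ 2 ≤ (‖u - w‖ + ‖w - v‖) ^ 2 := by gcongr
  nlinarith [sq_nonneg (‖u - w‖ - ‖w - v‖)]

/-- The error of a Galerkin approximation `(U, R)` of a solution `(V, H)` is controlled by the
distance of the solution from arbitrary comparison functions `(W, K)` in the trial spaces. Only the
velocities `U, V, W`, their gradients and the pressure gradients `R, H, K` enter. -/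
theorem galerkin_error_le (G : Submodule ℝ X) [G.HasOrthogonalProjection] {ν τ T α : ℝ} {N : ℕ}
    (hν : 0 < ν) (hτ : 0 < τ) (hτ1 : τ ≤ 1) (hT : 0 < T) (hN : N * τ ≤ T) (hα0 : 0 ≤ α)
    (hα : α ≤ 1 / 2)
    {U V W R H K : ℕ → X} {dU dV dW : ℕ → Y}
    (hR : ∀ n ≤ N, R n ∈ G) (hK : ∀ n, K n ∈ G)
    (hsat : ∀ n ≤ N, ∀ z ∈ G, |inner ℝ (U n - W n) z| ≤ α * ‖U n - W n‖ * ‖z‖)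
    (hU0 : ∀ n ≤ 2, n ≤ N → U n = W n) (hdU0 : ∀ n ≤ 2, n ≤ N → dU n = dW n)
    (hR0 : ∀ n ≤ 2, n ≤ N → R n = K n)
    (hmom : ∀ n, 2 ≤ n → n < N →
      1 / (2 * τ) * inner ℝ ((3 : ℝ) • (U (n + 1) - V (n + 1)) - (4 : ℝ) • (U n - V n)
          + (U (n - 1) - V (n - 1))) (U (n + 1) - W (n + 1))
        + ν * inner ℝ (dU (n + 1) - dV (n + 1)) (dU (n + 1) - dW (n + 1))
        + 1 / 3 * inner ℝ ((7 : ℝ) • (R n - H n) - (5 : ℝ) • (R (n - 1) - H (n - 1))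
          + (R (n - 2) - H (n - 2))) (U (n + 1) - W (n + 1)) = 0)
    (hproj : ∀ n, 2 ≤ n → n < N → ∀ z ∈ G,
      2 * τ / 3 * inner ℝ ((R (n + 1) - H (n + 1)) - (R n - H n)) z
        = inner ℝ (U (n + 1) - V (n + 1)) z) :
    ∑ n ∈ Finset.Ico 1 N, τ * ‖U (n + 1) - V (n + 1)‖ ^ 2
      + 2 * ν * ∑ n ∈ Finset.Ico 1 N, τ * ‖dU (n + 1) - dV (n + 1)‖ ^ 2
      + 4 * τ ^ 2 / 3 * ∑ n ∈ Finset.Ico 1 N, τ * ‖R (n + 1) - H (n + 1)‖ ^ 2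
    ≤ ((20 * T + 8) * (8960 * T + ν) + 4 * ν + 5) *
      (τ⁻¹ * ∑ n ∈ Finset.range (N + 1), ‖W n - V n‖ ^ 2
        + τ * ∑ n ∈ Finset.range (N + 1), ‖dW n - dV n‖ ^ 2
        + τ * ∑ n ∈ Finset.range (N + 1), ‖K n - H n‖ ^ 2) := by
  set a : ℕ → ℝ := fun n => ‖W n - V n‖ with ha
  set b : ℕ → ℝ := fun n => τ * ‖K n - H n‖ with hb
  set c : ℕ → ℝ := fun n => ‖dW n - dV n‖ with hc
  set e : ℕ → X := fun n => U n - W n with he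
  set de : ℕ → Y := fun n => dU n - dW n with hde
  -- beyond the final time the pressures are irrelevant
  set g : ℕ → X := fun n => if n ≤ N then τ • (R n - K n) else 0 with hg
  have hgn : ∀ n ≤ N, g n = τ • (R n - K n) := fun n hn => if_pos hn
  have hgG : ∀ n, g n ∈ G := by
    intro n
    simp only [hg]
    split_ifs with h
    · exact G.smul_mem _ (G.sub_mem (hR n h) (hK n))
    · exact G.zero_mem
  obtain ⟨st1, st2⟩ := scheme_stability (X := X) (Y := Y) G (ν := ν) (τ := τ) (T := T) (N := N)
    (e := e) (g := g) (de := de) (a := a) (b := b) (c := c) hν hτ hT hN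
    (fun n => norm_nonneg _) (fun n => by positivity) hgG
    (fun n hn => by
      refine (norm_starProjection_le_of_inner_le G (hsat n hn)).trans ?_
      refine mul_le_mul_of_nonneg_right ?_ (by positivity)
      nlinarith)
    (fun n h2 hn => by simp only [he]; rw [hU0 n h2 hn, sub_self])
    (fun n h2 hn => by rw [hgn n hn, hR0 n h2 hn, sub_self, smul_zero])
    (fun n h2 hn => by
      -- `ρ` collects the truncation errors in the pressure step. The remainder is its projection
      -- onto `G`, hence no longer than `ρ`.
      set ρ : X := (3 / 2 : ℝ) • (W (n + 1) - V (n + 1))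
        - τ • (K (n + 1) - H (n + 1)) + τ • (K n - H n) with hρ
      have hle : ‖g (n + 1) - g n - (3 / 2 : ℝ) • G.starProjection (e (n + 1))‖ ≤ ‖ρ‖ := by
        refine norm_le_of_inner_eq (G := G) (G.sub_mem (G.sub_mem (hgG _) (hgG _))
          (G.smul_mem _ (G.starProjection_apply_mem _))) fun z hz => ?_
        have h1 := hproj n h2 hn z hz
        have h3 := G.starProjection_inner_eq_zero (e (n + 1)) z hz
        rw [hgn _ (by omega), hgn _ (by omega)]
        simp only [hρ, he, inner_sub_left, inner_add_left, real_inner_smul_left] at h1 h3 ⊢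
        linarith
      refine hle.trans ?_
      refine (norm_add_le _ _).trans (add_le_add ((norm_sub_le _ _).trans (add_le_add ?_ ?_)) ?_)
      · simp [norm_smul, ha]
      · simp [norm_smul, hb, abs_of_pos hτ]
      · simp [norm_smul, hb, abs_of_pos hτ])
    (fun n h2 hn => by
      have h1 := hmom n h2 hn
      rw [hgn n (by omega), hgn (n - 1) (by omega), hgn (n - 2) (by omega)]
      set x : X := (3 : ℝ) • (W (n + 1) - V (n + 1)) - (4 : ℝ) • (W n - V n)
        + (W (n - 1) - V (n - 1)) with hx
      set y : X := (7 : ℝ) • (K n - H n) - (5 : ℝ) • (K (n - 1) - H (n - 1))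
        + (K (n - 2) - H (n - 2)) with hy
      have e1 : (3 : ℝ) • (U (n + 1) - V (n + 1)) - (4 : ℝ) • (U n - V n)
          + (U (n - 1) - V (n - 1)) = ((3 : ℝ) • e (n + 1) - (4 : ℝ) • e n + e (n - 1)) + x := by
        simp only [he, hx]; module
      have e2 : dU (n + 1) - dV (n + 1) = de (n + 1) + (dW (n + 1) - dV (n + 1)) := by
        simp only [hde]; abel
      have e3 : (7 : ℝ) • (R n - H n) - (5 : ℝ) • (R (n - 1) - H (n - 1))
          + (R (n - 2) - H (n - 2)) = ((7 : ℝ) • (R n - K n) - (5 : ℝ) • (R (n - 1) - K (n - 1))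
          + (R (n - 2) - K (n - 2))) + y := by
        simp only [hy]; module
      have e4 : (7 : ℝ) • τ • (R n - K n) - (5 : ℝ) • τ • (R (n - 1) - K (n - 1))
          + τ • (R (n - 2) - K (n - 2)) = τ • ((7 : ℝ) • (R n - K n)
          - (5 : ℝ) • (R (n - 1) - K (n - 1)) + (R (n - 2) - K (n - 2))) := by
        module
      change 1 / (2 * τ) * inner ℝ _ (e (n + 1)) + ν * inner ℝ _ (de (n + 1))
        + 1 / 3 * inner ℝ _ (e (n + 1)) = 0 at h1
      rw [e1, e2, e3, inner_add_left, inner_add_left (de (n + 1)), inner_add_left _ y,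
        real_inner_self_eq_norm_sq] at h1
      rw [e4, real_inner_smul_left]
      have nx : ‖x‖ ≤ 3 * a (n + 1) + 4 * a n + a (n - 1) := by
        refine (norm_add_le _ _).trans (add_le_add ((norm_sub_le _ _).trans ?_) le_rfl)
        simp [norm_smul, ha]
      have ny : τ * ‖y‖ ≤ 7 * b n + 5 * b (n - 1) + b (n - 2) := by
        have : ‖y‖ ≤ 7 * ‖K n - H n‖ + 5 * ‖K (n - 1) - H (n - 1)‖ + ‖K (n - 2) - H (n - 2)‖ := by
          refine (norm_add_le _ _).trans (add_le_add ((norm_sub_le _ _).trans ?_) le_rfl)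
          simp [norm_smul]
        refine (mul_le_mul_of_nonneg_left this hτ.le).trans (le_of_eq ?_)
        simp only [hb]; ring
      have cx := (neg_le_of_abs_le (abs_real_inner_le_norm x (e (n + 1))))
      have cy := (neg_le_of_abs_le (abs_real_inner_le_norm y (e (n + 1))))
      have cd := (neg_le_of_abs_le (abs_real_inner_le_norm (dW (n + 1) - dV (n + 1)) (de (n + 1))))
      have mx := mul_le_mul_of_nonneg_right nx (norm_nonneg (e (n + 1)))
      have my := mul_le_mul_of_nonneg_right ny (norm_nonneg (e (n + 1)))
      have md := mul_le_mul_of_nonneg_left cd (by positivity : 0 ≤ ν * τ)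
      have my' := mul_le_mul_of_nonneg_left cy hτ.le
      have h2 := congrArg (fun t => τ * t) h1
      simp only [mul_zero, mul_add] at h2
      have h3 : ∀ t, τ * (1 / (2 * τ) * t) = 1 / 2 * t := fun t => by field_simp
      simp only [h3] at h2
      change ν * τ * -(c (n + 1) * _) ≤ _ at md
      linarith)
  set Sa := ∑ n ∈ Finset.range (N + 1), ‖W n - V n‖ ^ 2 with hSa
  set Sc := ∑ n ∈ Finset.range (N + 1), ‖dW n - dV n‖ ^ 2 with hSc
  set Sb := ∑ n ∈ Finset.range (N + 1), ‖K n - H n‖ ^ 2 with hSb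
  have hSa0 : 0 ≤ Sa := Finset.sum_nonneg fun _ _ => by positivity
  have hSb0 : 0 ≤ Sb := Finset.sum_nonneg fun _ _ => by positivity
  have hSc0 : 0 ≤ Sc := Finset.sum_nonneg fun _ _ => by positivity
  set M := 4480 * (T / τ) * ∑ j ∈ Finset.range (N + 1), (a j + b j) ^ 2
          + ν * τ * ∑ j ∈ Finset.range (N + 1), c j ^ 2 with hM
  have hM0 : 0 ≤ M := by positivity
  have hMle : M ≤ (8960 * T + ν) * (τ⁻¹ * Sa + τ * Sc + τ * Sb) := by
    have h1 : ∑ j ∈ Finset.range (N + 1), (a j + b j) ^ 2 ≤ 2 * Sa + 2 * τ ^ 2 * Sb := by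
      rw [hSa, hSb, Finset.mul_sum, Finset.mul_sum, ← Finset.sum_add_distrib]
      refine Finset.sum_le_sum fun n _ => ?_
      simp only [ha, hb]
      nlinarith [sq_nonneg (‖W n - V n‖ - τ * ‖K n - H n‖)]
    have h2 := mul_le_mul_of_nonneg_left h1 (by positivity : 0 ≤ 4480 * (T / τ))
    have h3 : 4480 * (T / τ) * (2 * Sa + 2 * τ ^ 2 * Sb)
        = 8960 * T * (τ⁻¹ * Sa + τ * Sb) := by field_simp; ring
    have h4 : 0 ≤ 8960 * T * (τ * Sc) + ν * (τ⁻¹ * Sa + τ * Sb) := by positivity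
    rw [hM]
    change _ + ν * τ * Sc ≤ _
    linarith
  have bound : ∀ (f : ℕ → ℝ), (∀ n, 0 ≤ f n) → ∑ n ∈ Finset.Ico 1 N, f (n + 1)
      ≤ ∑ n ∈ Finset.range (N + 1), f n := by
    intro f hf
    rw [← Finset.sum_image (f := f) (g := fun n => n + 1) (s := Finset.Ico 1 N)
      (fun i _ j _ h => Nat.succ_injective h)]
    refine Finset.sum_le_sum_of_subset_of_nonneg ?_ fun i _ _ => hf i
    intro j hj
    simp only [Finset.mem_image, Finset.mem_Ico, Finset.mem_range] at hj ⊢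
    omega
  have const : ∀ (f : ℕ → ℝ) (m : ℝ), 0 ≤ m → (∀ n, 2 ≤ n → n ≤ N → f n ≤ m) →
      τ * ∑ n ∈ Finset.Ico 1 N, f (n + 1) ≤ T * m := by
    intro f m hm hf
    have h1 : ∑ n ∈ Finset.Ico 1 N, f (n + 1) ≤ ∑ n ∈ Finset.Ico 1 N, m := by
      refine Finset.sum_le_sum fun n hn => hf _ ?_ ?_ <;>
      · rw [Finset.mem_Ico] at hn
        omega
    rw [Finset.sum_const, Nat.card_Ico, nsmul_eq_mul] at h1
    have h2 : ((N - 1 : ℕ) : ℝ) ≤ N := by exact_mod_cast Nat.sub_le N 1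
    calc τ * ∑ n ∈ Finset.Ico 1 N, f (n + 1) ≤ τ * (((N - 1 : ℕ) : ℝ) * m) := by gcongr
      _ ≤ τ * (N * m) := by gcongr
      _ = N * τ * m := by ring
      _ ≤ T * m := by gcongr
  have l1 : ∑ n ∈ Finset.Ico 1 N, τ * ‖U (n + 1) - V (n + 1)‖ ^ 2 ≤ 12 * T * M + 2 * τ * Sa := by
    -- From `(3/16) ‖e‖² ≤ M`, with `16/3` rounded up to `6`.
    have h1 : τ * ∑ n ∈ Finset.Ico 1 N, ‖e (n + 1)‖ ^ 2 ≤ T * (6 * M) :=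
      const (fun n => ‖e n‖ ^ 2) _ (by positivity) fun n h2 hn => by
        have := st1 n h2 hn
        have : 0 ≤ ‖g n‖ ^ 2 := by positivity
        linarith
    have h2 := bound (fun n => ‖W n - V n‖ ^ 2) (fun n => by positivity)
    have h3 : ∑ n ∈ Finset.Ico 1 N, ‖U (n + 1) - V (n + 1)‖ ^ 2 ≤
        2 * ∑ n ∈ Finset.Ico 1 N, ‖e (n + 1)‖ ^ 2
          + 2 * ∑ n ∈ Finset.Ico 1 N, ‖W (n + 1) - V (n + 1)‖ ^ 2 := by
      rw [Finset.mul_sum, Finset.mul_sum, ← Finset.sum_add_distrib]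
      exact Finset.sum_le_sum fun n _ => norm_sub_sq_le _ _ _
    rw [← Finset.mul_sum]
    have h4 := mul_le_mul_of_nonneg_left h3 hτ.le
    have h5 := mul_le_mul_of_nonneg_left h2 hτ.le
    linarith
  have l2 : 2 * ν * ∑ n ∈ Finset.Ico 1 N, τ * ‖dU (n + 1) - dV (n + 1)‖ ^ 2
      ≤ 8 * M + 4 * ν * τ * Sc := by
    -- The extra term `n = 1` belongs to level `2`, a starting level without discrete error.
    have h1 : ∑ n ∈ Finset.Ico 1 N, ‖de (n + 1)‖ ^ 2 = ∑ n ∈ Finset.Ico 2 N, ‖de (n + 1)‖ ^ 2 := by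
      rcases lt_or_ge N 2 with h | h
      · rw [Finset.Ico_eq_empty (by omega), Finset.Ico_eq_empty (by omega)]
      · rw [Finset.sum_eq_sum_Ico_succ_bot (by omega)]
        simp only [hde]
        rw [hdU0 (1 + 1) (by norm_num) (by omega), sub_self, norm_zero]
        simp
    have h2 := bound (fun n => ‖dW n - dV n‖ ^ 2) (fun n => by positivity)
    have h3 : ∑ n ∈ Finset.Ico 1 N, ‖dU (n + 1) - dV (n + 1)‖ ^ 2 ≤
        2 * ∑ n ∈ Finset.Ico 1 N, ‖de (n + 1)‖ ^ 2
          + 2 * ∑ n ∈ Finset.Ico 1 N, ‖dW (n + 1) - dV (n + 1)‖ ^ 2 := by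
      rw [Finset.mul_sum, Finset.mul_sum, ← Finset.sum_add_distrib]
      exact Finset.sum_le_sum fun n _ => norm_sub_sq_le _ _ _
    rw [← Finset.mul_sum]
    rw [h1] at h3
    have h4 := mul_le_mul_of_nonneg_left h3 (by positivity : 0 ≤ 2 * ν * τ)
    have h5 := mul_le_mul_of_nonneg_left h2 (by positivity : 0 ≤ 4 * ν * τ)
    linarith
  have l3 : 4 * τ ^ 2 / 3 * ∑ n ∈ Finset.Ico 1 N, τ * ‖R (n + 1) - H (n + 1)‖ ^ 2
      ≤ 8 * T * M + 8 / 3 * τ * Sb := by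
    have h1 : τ * ∑ n ∈ Finset.Ico 1 N, τ ^ 2 * ‖R (n + 1) - K (n + 1)‖ ^ 2 ≤ T * (3 * M) :=
      const (fun n => τ ^ 2 * ‖R n - K n‖ ^ 2) _ (by positivity) fun n h2 hn => by
        have h3 := st1 n h2 hn
        have : 0 ≤ ‖e n‖ ^ 2 := by positivity
        rw [hgn n hn, norm_smul, mul_pow, Real.norm_eq_abs, sq_abs] at h3
        linarith
    have h2 := bound (fun n => ‖K n - H n‖ ^ 2) (fun n => by positivity)
    have h3 : ∑ n ∈ Finset.Ico 1 N, ‖R (n + 1) - H (n + 1)‖ ^ 2 ≤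
        2 * ∑ n ∈ Finset.Ico 1 N, ‖R (n + 1) - K (n + 1)‖ ^ 2
          + 2 * ∑ n ∈ Finset.Ico 1 N, ‖K (n + 1) - H (n + 1)‖ ^ 2 := by
      rw [Finset.mul_sum, Finset.mul_sum, ← Finset.sum_add_distrib]
      exact Finset.sum_le_sum fun n _ => norm_sub_sq_le _ _ _
    rw [← Finset.mul_sum] at h1 ⊢
    have h4 := mul_le_mul_of_nonneg_left h3 (by positivity : 0 ≤ 4 * τ ^ 2 / 3 * τ)
    have h5 := mul_le_mul_of_nonneg_left h2 (by positivity : 0 ≤ 8 / 3 * τ ^ 2 * τ)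
    have h6 : τ ^ 2 ≤ 1 := pow_le_one₀ hτ.le hτ1
    have h7 := mul_le_mul_of_nonneg_right h6 (by positivity : 0 ≤ 8 / 3 * τ * Sb)
    linarith
  have hττ : τ ≤ τ⁻¹ := hτ1.trans ((one_le_inv₀ hτ).2 hτ1)
  have l4 := mul_le_mul_of_nonneg_right hττ hSa0
  have l5 := mul_le_mul_of_nonneg_left hMle (by positivity : 0 ≤ 20 * T + 8)
  have l6 : 0 ≤ τ * Sc := by positivity
  have l7 : 0 ≤ τ * Sb := by positivity
  have l8 : 0 ≤ τ⁻¹ * Sa := by positivity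
  have l9 : 0 ≤ ν * (τ⁻¹ * Sa) := by positivity
  have l10 : 0 ≤ ν * (τ * Sb) := by positivity
  linarith

end Hilbert

theorem velVal_sub {Ω : Set Plane} (u v : Vel Ω) : velVal (u - v) = velVal u - velVal v := rfl

theorem velGrad_sub {Ω : Set Plane} (u v : Vel Ω) : velGrad (u - v) = velGrad u - velGrad v := rfl

/-! ### Error equations of the two schemes -/

section Schemes

variable {Ω : Set Plane} {𝒯 : Set (Finset Plane)} {ν τ : ℝ} {N : ℕ} {f : ℕ → L2Vec Ω}
  {uh ur : ℕ → Vel Ω} {ph pr : ℕ → Scalar Ω} {U : Submodule ℝ (Vel Ω)}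
  {Q : Submodule ℝ (Scalar Ω)}

/-- The error equation of the momentum balance. -/
theorem momentum_error (hF : IsFOMSolution Ω 𝒯 ν τ N f uh ph)
    (hR : IsROMSolution U Q ν τ N f ur pr) (hU : U ≤ velocitySubmodule Ω 𝒯)
    (hQ : Q ≤ H1 Ω) {n : ℕ} (h2 : 2 ≤ n) (hn : n < N) {v : Vel Ω} (hv : v ∈ U) :
    1 / (2 * τ) * inner ℝ ((3 : ℝ) • (velVal (ur (n + 1)) - velVal (uh (n + 1)))
          - (4 : ℝ) • (velVal (ur n) - velVal (uh n))
          + (velVal (ur (n - 1)) - velVal (uh (n - 1)))) (velVal v)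
        + ν * inner ℝ (velGrad (ur (n + 1)) - velGrad (uh (n + 1))) (velGrad v)
        + 1 / 3 * inner ℝ ((7 : ℝ) • ((pr n).2 - (ph n).2)
          - (5 : ℝ) • ((pr (n - 1)).2 - (ph (n - 1)).2)
          + ((pr (n - 2)).2 - (ph (n - 2)).2)) (velVal v) = 0 := by
  have hvh : v ∈ velocitySpace Ω 𝒯 := hU hv
  have e1 := hF.momentum n h2 hn v hvh
  have e2 := hR.momentum n h2 hn v hv
  have hp : (7 : ℝ) • pr n - (5 : ℝ) • pr (n - 1) + pr (n - 2) ∈ H1 Ω :=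
    add_mem (sub_mem (Submodule.smul_mem _ _ (hQ (hR.pres_mem n (by omega))))
      (Submodule.smul_mem _ _ (hQ (hR.pres_mem (n - 1) (by omega)))))
      (hQ (hR.pres_mem (n - 2) (by omega)))
  -- The reduced scheme pairs the pressure with a divergence, the full scheme pairs its gradient
  -- with the test field; this step brings them to the same form.
  rw [inner_velDiv_eq_neg hp fun i => (hvh i).1] at e2
  have hval : ∀ x y z : Vel Ω, velVal ((3 : ℝ) • x - (4 : ℝ) • y + z)
      = (3 : ℝ) • velVal x - (4 : ℝ) • velVal y + velVal z := fun _ _ _ => rfl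
  simp only [hval, Prod.snd_add, Prod.snd_sub, Prod.smul_snd, inner_add_left, inner_sub_left,
    real_inner_smul_left] at e1 e2 ⊢
  linarith

/-- The error equation of the pressure projection step. -/
theorem projection_error (hF : IsFOMSolution Ω 𝒯 ν τ N f uh ph)
    (hR : IsROMSolution U Q ν τ N f ur pr) (hU : U ≤ velocitySubmodule Ω 𝒯)
    (hQ : ∀ q ∈ Q, q ∈ pressureSpace Ω 𝒯) {n : ℕ} (h2 : 2 ≤ n) (hn : n < N) {q : Scalar Ω}
    (hq : q ∈ Q) :
    2 * τ / 3 * inner ℝ (((pr (n + 1)).2 - (ph (n + 1)).2) - ((pr n).2 - (ph n).2)) q.2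
      = inner ℝ (velVal (ur (n + 1)) - velVal (uh (n + 1))) q.2 := by
  have hqh := hQ q hq
  have e1 := hF.projection n h2 hn q hqh
  have e2 := hR.projection n h2 hn q hq
  have hur : ur (n + 1) ∈ velocitySpace Ω 𝒯 := hU (hR.vel_mem _ (by omega))
  rw [real_inner_comm, inner_velDiv_eq_neg hqh.1 fun i => (hF.vel_mem (n + 1) (by omega) i).1,
    real_inner_comm] at e1
  rw [real_inner_comm, inner_velDiv_eq_neg hqh.1 fun i => (hur i).1, real_inner_comm] at e2
  simp only [Prod.snd_sub, inner_sub_left] at e1 e2 ⊢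
  linarith

/-- The reduced-order error in terms of comparison functions in the reduced spaces that coincide
with the reduced-order solution at the starting levels. -/
theorem rom_error_le {T α : ℝ} (hν : 0 < ν) (hτ : 0 < τ) (hτ1 : τ ≤ 1) (hT : 0 < T)
    (hN : N * τ ≤ T) (hα0 : 0 ≤ α) (hα : α ≤ 1 / 2) [FiniteDimensional ℝ Q]
    (hF : IsFOMSolution Ω 𝒯 ν τ N f uh ph) (hR : IsROMSolution U Q ν τ N f ur pr)
    (hU : U ≤ velocitySubmodule Ω 𝒯) (hQ : ∀ q ∈ Q, q ∈ pressureSpace Ω 𝒯)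
    (hsat : SaturationBound (velVal '' (U : Set (Vel Ω))) (Prod.snd '' (Q : Set (Scalar Ω))) α)
    {Pu : ℕ → Vel Ω} {Pp : ℕ → Scalar Ω} (hPu : ∀ n, Pu n ∈ U) (hPp : ∀ n, Pp n ∈ Q)
    (h0 : ∀ n ≤ 2, n ≤ N → velVal (ur n) = velVal (Pu n))
    (h1 : ∀ n ≤ 2, n ≤ N → velGrad (ur n) = velGrad (Pu n))
    (h2 : ∀ n ≤ 2, n ≤ N → (pr n).2 = (Pp n).2) :
    ∑ n ∈ Finset.Ico 1 N, τ * ‖velVal (ur (n + 1) - uh (n + 1))‖ ^ 2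
        + 2 * ν * ∑ n ∈ Finset.Ico 1 N, τ * ‖velGrad (ur (n + 1) - uh (n + 1))‖ ^ 2
        + 4 * τ ^ 2 / 3 * ∑ n ∈ Finset.Ico 1 N, τ * ‖(pr (n + 1) - ph (n + 1)).2‖ ^ 2
    ≤ ((20 * T + 8) * (8960 * T + ν) + 4 * ν + 5) *
      (τ⁻¹ * ∑ n ∈ Finset.range (N + 1), ‖velVal (Pu n) - velVal (uh n)‖ ^ 2
        + τ * ∑ n ∈ Finset.range (N + 1), ‖velGrad (Pu n) - velGrad (uh n)‖ ^ 2
        + τ * ∑ n ∈ Finset.range (N + 1), ‖(Pp n).2 - (ph n).2‖ ^ 2) := by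
  have hsat' : ∀ n ≤ N, ∀ y ∈ Q.map (LinearMap.snd ℝ (L2 Ω) (L2Vec Ω)),
      |inner ℝ (velVal (ur n) - velVal (Pu n)) y|
        ≤ α * ‖velVal (ur n) - velVal (Pu n)‖ * ‖y‖ := by
    intro n hn y hy
    obtain ⟨q, hq, rfl⟩ := hy
    rw [← velVal_sub]
    exact hsat _ (Set.mem_image_of_mem _ (sub_mem (hR.vel_mem n hn) (hPu n))) _
      (Set.mem_image_of_mem _ hq)
  have hproj : ∀ n, 2 ≤ n → n < N → ∀ y ∈ Q.map (LinearMap.snd ℝ (L2 Ω) (L2Vec Ω)),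
      2 * τ / 3 * inner ℝ (((pr (n + 1)).2 - (ph (n + 1)).2) - ((pr n).2 - (ph n).2)) y
        = inner ℝ (velVal (ur (n + 1)) - velVal (uh (n + 1))) y := by
    intro n h2 hn y hy
    obtain ⟨q, hq, rfl⟩ := hy
    exact projection_error hF hR hU hQ h2 hn hq
  have hmom := fun n h2 hn => momentum_error hF hR hU (fun q hq => (hQ q hq).1) (n := n) h2 hn
      (sub_mem (hR.vel_mem (n + 1) hn) (hPu (n + 1)))
  simp only [velVal_sub, velGrad_sub] at hmom
  simp only [velVal_sub, velGrad_sub, Prod.snd_sub]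
  have hRG : ∀ n ≤ N, (pr n).2 ∈ Q.map (LinearMap.snd ℝ (L2 Ω) (L2Vec Ω)) := fun n hn =>
    ⟨pr n, hR.pres_mem n hn, rfl⟩
  have hKG : ∀ n, (Pp n).2 ∈ Q.map (LinearMap.snd ℝ (L2 Ω) (L2Vec Ω)) := fun n =>
    ⟨Pp n, hPp n, rfl⟩
  have hG : FiniteDimensional ℝ (Q.map (LinearMap.snd ℝ (L2 Ω) (L2Vec Ω))) := inferInstance
  generalize Q.map (LinearMap.snd ℝ (L2 Ω) (L2Vec Ω)) = G at *
  exact galerkin_error_le G hν hτ hτ1 hT hN hα0 hα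
    (U := fun n => velVal (ur n)) (V := fun n => velVal (uh n))
    (W := fun n => velVal (Pu n)) (R := fun n => (pr n).2) (H := fun n => (ph n).2)
    (K := fun n => (Pp n).2) (dU := fun n => velGrad (ur n)) (dV := fun n => velGrad (uh n))
    (dW := fun n => velGrad (Pu n)) hRG hKG hsat' h0 h1 h2 hmom hproj

end Schemes

/-- Only `(N + 1) τ ≤ T + 1` is needed to pass from sums over the levels to the truncated modes. -/
theorem scaled_sum_le {ν τ T C N A B D E : ℝ} (hν : 0 < ν) (hτ : 0 < τ) (hτ1 : τ ≤ 1)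
    (hN : N * τ ≤ T) (hT : 0 < T) (hC : 0 ≤ C) {x : ℝ} (hx : 0 ≤ x) (hA : 0 ≤ A) (hB : 0 ≤ B)
    (hD : 0 ≤ D) (hE : 0 ≤ E) :
    C * (τ⁻¹ * ((N + 1) * A) + τ * ((N + 1) * B) + τ * ((N + 1) * D)) ≤
      C * (T + 1) * (1 + 1 / ν) * Real.exp x * (ν * τ⁻¹ ^ 2 * A + B + (E + D)) := by
  have h1 : τ⁻¹ * ((N + 1) * A) + τ * ((N + 1) * B) + τ * ((N + 1) * D)
      = ((N + 1) * τ) * (τ⁻¹ ^ 2 * A + B + D) := by field_simp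
  have h2 : (N + 1) * τ ≤ T + 1 := by linarith
  -- The factor `1 + 1 / ν` compensates for the `ν` in front of `τ⁻² A` on the right.
  have h3 : τ⁻¹ ^ 2 * A + B + D ≤ (1 + 1 / ν) * (ν * τ⁻¹ ^ 2 * A + B + (E + D)) := by
    have : (1 + 1 / ν) * (ν * τ⁻¹ ^ 2 * A + B + (E + D)) = τ⁻¹ ^ 2 * A + B + D
        + (ν * τ⁻¹ ^ 2 * A + E + 1 / ν * (B + (E + D))) := by field_simp; ring
    have h4 : 0 ≤ ν * τ⁻¹ ^ 2 * A + E + 1 / ν * (B + (E + D)) := by positivity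
    linarith
  have hexp : 1 ≤ Real.exp x := Real.one_le_exp hx
  rw [h1]
  calc C * ((N + 1) * τ * (τ⁻¹ ^ 2 * A + B + D))
      ≤ C * ((T + 1) * ((1 + 1 / ν) * (ν * τ⁻¹ ^ 2 * A + B + (E + D)))) := by gcongr
    _ = C * (T + 1) * (1 + 1 / ν) * 1 * (ν * τ⁻¹ ^ 2 * A + B + (E + D)) := by ring
    _ ≤ C * (T + 1) * (1 + 1 / ν) * Real.exp x * (ν * τ⁻¹ ^ 2 * A + B + (E + D)) := by gcongr

end StokesROM

end

/-! ### Assembly of the estimate -/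

open StokesROM in
theorem theorem2 (Ω : Set Plane) (hΩ_open : IsOpen Ω) (hΩ_conn : IsConnected Ω)
    (hΩ_bdd : Bornology.IsBounded Ω) (ν T : ℝ) (hν : 0 < ν) (hT : 0 < T) :
    ∃ C : ℝ → ℝ,
      ∀ α : ℝ, 0 ≤ α → α < 3 / 8 →
      ∀ τ : ℝ, 0 < τ → τ < 4 * (1 - 8 / 3 * α) / 17 →
      -- the number of time steps
      ∀ N : ℕ, N = ⌊T / τ⌋₊ →
      -- the full-order solution
      ∀ 𝒯 : Set (Finset Plane), IsTriangulation Ω 𝒯 →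
      ∀ (f : ℕ → L2Vec Ω) (uh : ℕ → Vel Ω) (ph : ℕ → Scalar Ω),
        IsFOMSolution Ω 𝒯 ν τ N f uh ph →
      -- the inner products of the POD
      ∀ au bu ap bp : ℝ, 0 ≤ au → 0 ≤ bu → 0 < au + bu → 0 ≤ ap → 0 ≤ bp → 0 < ap + bp →
      -- the POD of the velocity and pressure snapshots
      ∀ (lam : Fin (N + 1) → ℝ) (w : Fin (N + 1) → EuclideanSpace ℝ (Fin (N + 1))),
        IsPODSystem (velInner au bu) N uh lam w →
      ∀ (sig : Fin (N + 1) → ℝ) (z : Fin (N + 1) → EuclideanSpace ℝ (Fin (N + 1))),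
        IsPODSystem (presInner ap bp) N ph sig z →
      ∀ Nu Np : ℕ, Nu ≤ N + 1 → Np ≤ N + 1 →
        SaturationBound (velVal '' (podSpace N uh lam w Nu : Set (Vel Ω)))
          (Prod.snd '' (podSpace N ph sig z Np : Set (Scalar Ω))) α →
      -- the reduced-order solution, started from the projections of the full-order starting values
      ∀ (ur : ℕ → Vel Ω) (pr : ℕ → Scalar Ω),
        IsROMSolution (podSpace N uh lam w Nu) (podSpace N ph sig z Np) ν τ N f ur pr →
        (∀ n ≤ 2, n ≤ N →
          IsProjection (velInner au bu) (podSpace N uh lam w Nu) (uh n) (ur n) ∧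
          IsProjection (presInner ap bp) (podSpace N ph sig z Np) (ph n) (pr n)) →
      ∑ n ∈ Finset.Ico 1 N, τ * ‖velVal (ur (n + 1) - uh (n + 1))‖ ^ 2
        + 2 * ν * ∑ n ∈ Finset.Ico 1 N, τ * ‖velGrad (ur (n + 1) - uh (n + 1))‖ ^ 2
        + 4 * τ ^ 2 / 3 * ∑ n ∈ Finset.Ico 1 N, τ * ‖(pr (n + 1) - ph (n + 1)).2‖ ^ 2
      ≤ C α * Real.exp (T * ((7 * τ + 4 * α) / 2)) *
        (∑ i ∈ Finset.univ.filter (fun i : Fin (N + 1) => Nu ≤ (i : ℕ)),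
            lam i * (ν * τ⁻¹ ^ 2 * ‖velVal (podMode N uh lam w i)‖ ^ 2
              + ‖velGrad (podMode N uh lam w i)‖ ^ 2)
          + ∑ i ∈ Finset.univ.filter (fun i : Fin (N + 1) => Np ≤ (i : ℕ)),
            sig i * (ν * ‖(podMode N ph sig z i).1‖ ^ 2 + ‖(podMode N ph sig z i).2‖ ^ 2)) := by
  -- The stability constant, times `T + 1` from `(N + 1) τ ≤ T + 1`, times the price `1 + 1 / ν` of
  -- the weight `ν`. It does not vary with `α`, since only `α ≤ 1/2` enters.
  refine ⟨fun _ => ((20 * T + 8) * (8960 * T + ν) + 4 * ν + 5) * (T + 1) * (1 + 1 / ν), ?_⟩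
  intro α hα0 hα τ hτ hτα N hN 𝒯 _ f uh ph hF au bu ap bp hau hbu habu hap hbp habp
    lam w hlam sig z hsig Nu Np _ _ hsat ur pr hR hinit
  have hτ1 : τ ≤ 1 := by linarith
  have hNT : N * τ ≤ T := by
    rw [hN]
    have := Nat.floor_le (by positivity : 0 ≤ T / τ)
    rwa [le_div_iff₀ hτ] at this
  rw [velInner_eq_pullbackForm] at hlam hinit
  rw [presInner_eq_pullbackForm] at hsig hinit
  have hBu0 := pullbackForm_self_nonneg (L₁ := velValₗ Ω) (L₂ := velGradₗ Ω) hau hbu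
  have hBp0 := pullbackForm_self_nonneg (L₁ := LinearMap.fst ℝ (L2 Ω) (L2Vec Ω))
    (L₂ := LinearMap.snd ℝ (L2 Ω) (L2Vec Ω)) hap hbp
  have hMu : ∀ n ≤ N, uh n ∈ velocitySubmodule Ω 𝒯 := hF.vel_mem
  have hMp : ∀ n ≤ N, ph n ∈ pressureSubmodule 𝒯 hΩ_bdd := hF.pres_mem
  have hval : ∀ v ∈ velocitySubmodule Ω 𝒯,
      pullbackForm au bu (velValₗ Ω) (velGradₗ Ω) v v = 0 → velValₗ Ω v = 0 := fun v hv h =>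
    (pullbackForm_self_eq_zero hau hbu habu h).elim id fun h' =>
      (velVal_eq_zero_iff hΩ_open hΩ_bdd fun i => (hv i).1).2 h'
  have hgrad : ∀ v ∈ velocitySubmodule Ω 𝒯,
      pullbackForm au bu (velValₗ Ω) (velGradₗ Ω) v v = 0 → velGradₗ Ω v = 0 := fun v hv h =>
    (velVal_eq_zero_iff hΩ_open hΩ_bdd fun i => (hv i).1).1 (hval v hv h)
  have hpres : ∀ q ∈ pressureSubmodule 𝒯 hΩ_bdd,
      pullbackForm ap bp (LinearMap.fst ℝ (L2 Ω) (L2Vec Ω))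
        (LinearMap.snd ℝ (L2 Ω) (L2Vec Ω)) q q = 0 →
      LinearMap.snd ℝ (L2 Ω) (L2Vec Ω) q = 0 := fun q hq h =>
    (pullbackForm_self_eq_zero hap hbp habp h).elim
      (fun h' => snd_eq_zero_of_fst_eq_zero hΩ_open hΩ_bdd hq.1 h') id
  have hlam0 := hlam.eigenvalue_nonneg hBu0
  have hsig0 := hsig.eigenvalue_nonneg hBp0
  have s1 := hlam.sum_norm_sq_sub hBu0 hMu hval Nu
  have s2 := hlam.sum_norm_sq_sub hBu0 hMu hgrad Nu
  have s3 := hsig.sum_norm_sq_sub hBp0 hMp hpres Np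
  refine (rom_error_le hν hτ hτ1 hT hNT hα0 (by linarith) hF hR (podSpace_le lam w Nu hMu)
    (podSpace_le sig z Np hMp) hsat (podTrunc_mem N uh lam w Nu) (podTrunc_mem N ph sig z Np)
    (fun n h2 hn => hlam.map_projection_eq hBu0 hMu hval hn (hinit n h2 hn).1)
    (fun n h2 hn => hlam.map_projection_eq hBu0 hMu hgrad hn (hinit n h2 hn).1)
    (fun n h2 hn => hsig.map_projection_eq hBp0 hMp hpres hn (hinit n h2 hn).2)).trans ?_
  refine (le_of_eq (congrArg (fun t => _ * t) (congrArg₂ (· + ·) (congrArg₂ (· + ·)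
    (congrArg (τ⁻¹ * ·) s1) (congrArg (τ * ·) s2)) (congrArg (τ * ·) s3)))).trans ?_
  have hx : 0 ≤ T * ((7 * τ + 4 * α) / 2) := by positivity
  -- The tail `E` of the pressure values is not produced by the error estimate; it is nonnegative
  -- and is added for free, as is the exponential factor.
  refine (scaled_sum_le hν hτ hτ1 hNT hT (by positivity) hx
    (Finset.sum_nonneg fun i _ => mul_nonneg (hlam0 i) (sq_nonneg _))
    (Finset.sum_nonneg fun i _ => mul_nonneg (hlam0 i) (sq_nonneg _))
    (Finset.sum_nonneg fun i _ => mul_nonneg (hsig0 i) (sq_nonneg _))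
    (E := ∑ i ∈ Finset.univ.filter (fun i : Fin (N + 1) => Np ≤ (i : ℕ)),
      sig i * (ν * ‖(podMode N ph sig z i).1‖ ^ 2))
    (Finset.sum_nonneg fun i _ => mul_nonneg (hsig0 i) (by positivity))).trans (le_of_eq ?_)
  congr 1
  rw [Finset.mul_sum, ← Finset.sum_add_distrib, ← Finset.sum_add_distrib]
  refine congrArg₂ (· + ·) (Finset.sum_congr rfl fun i _ => ?_)
    (Finset.sum_congr rfl fun i _ => (mul_add _ _ _).symm)
  rw [mul_add]
  refine congrArg₂ (· + ·) ?_ rfl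
  exact mul_left_comm _ _ _
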